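/- \textbf{Theorem} (the dual of a Hopf $^*$-algebra with a positive integral is a discrete quantum group). Let $(B,\Delta)$ be a Hopf $^*$-algebra over $\mathbb C$ (a complex Hopf algebra with an involution making $B$ a $^*$-algebra and $\Delta:B\to B\otimes B$ a $^*$-homomorphism), with counit $\varepsilon_B$ and antipode $S$, and let $\varphi_B$ be a positive integral on $B$: a non-zero linear functional with $(\iota\otimes\varphi_B)\Delta(b)=\varphi_B(b)1$ and $\varphi_B(b^*b)\ge 0$ for all $b\in B$. Let $(A,\Delta)$ be its dual, that is, $A=\{\varphi_B(\,\cdot\,b): b\in B\}$, a space of linear functionals on $B$, with $$\langle aa',x\rangle=\langle a\otimes a',\Delta(x)\rangle,\qquad \langle a^*,x\rangle=\overline{\langle a,S(x)^*\rangle},\qquad \langle\Delta(a),x\otimes y\rangle=\langle a,yx\rangle ,$$ where $\Delta(a)$ lies in the multiplier algebra $M(A\otimes A)$. Then $(A,\Delta)$ is a discrete quantum group: the $^*$-algebra $A$ is $^*$-isomorphic to an algebraic direct sum of full matrix algebras $M_{n(\alpha)}(\mathbb C)$, $n(\alpha)\geq 1$, and $(A,\Delta)$ is a multiplier Hopf $^*$-algebra,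 i.e. the product of $A$ is non-degenerate, $\Delta:A\to M(A\otimes A)$ is a coassociative $^*$-homomorphism, and $a\otimes b\mapsto\Delta(a)(1\otimes b)$ and $a\otimes b\mapsto(a\otimes 1)\Delta(b)$ define bijections of $A\otimes A$ onto itself. Moreover, $\varepsilon_A(a)=\langle a,1\rangle$ is the counit of $(A,\Delta)$; the element $h=\varphi_B(1)^{-1}\varphi_B$ of $A$ is non-zero, satisfies $ah=\varepsilon_A(a)h=ha$ for all $a\in A$ (it is a left and right cointegral), and $h^*=h=h^2$; and there is a linear functional $\varphi_A$ on $A$ with $\varphi_A(\varphi_B(\,\cdot\,b))=\varepsilon_B(b)$ for all $b\in B$, which is a left integral on $(A,\Delta)$ (non-zero, with $(\iota\otimes\varphi_A)\Delta(a)=\varphi_A(a)1$), is positive ($\varphi_A(a^*a)\ge0$ for all $a \in A$), and satisfies $\varphi_A(a^*a)=\varphi_B(b^*b)$ for $a=\varphi_B(\,\cdot\,b)$. -/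

import Mathlib

open scoped TensorProduct ComplexOrder

universe u

namespace QuantumGroup

set_option linter.unusedSectionVars false

section Multiplier

variable (R : Type u) [NonUnitalRing R] [Module ℂ R] [IsScalarTower ℂ R R] [SMulCommClass ℂ R R]

/-- The algebra of two-sided multipliers of `R`: pairs `(L, R)` of linear maps
(left multiplication by `m` and right multiplication by `m`) with `x (m y) = (x m) y`. -/
def multiplierSubalgebra : Subalgebra ℂ (Module.End ℂ R × (Module.End ℂ R)ᵐᵒᵖ) where
  carrier := {m | (∀ x y, m.1 (x * y) = m.1 x * y) ∧
    (∀ x y, m.2.unop (x * y) = x * m.2.unop y) ∧ ∀ x y, x * m.1 y = m.2.unop x * y}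
  mul_mem' := by
    rintro a b ⟨ha1, ha2, ha3⟩ ⟨hb1, hb2, hb3⟩
    refine ⟨fun x y => ?_, fun x y => ?_, fun x y => ?_⟩
    · simp [ha1, hb1]
    · simp [ha2, hb2]
    · simp [ha3, hb3]
  add_mem' := by
    rintro a b ⟨ha1, ha2, ha3⟩ ⟨hb1, hb2, hb3⟩
    refine ⟨fun x y => ?_, fun x y => ?_, fun x y => ?_⟩
    · simp [ha1, hb1, add_mul]
    · simp [ha2, hb2, mul_add]
    · simp [ha3, hb3, mul_add, add_mul]
  algebraMap_mem' := by
    intro c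
    refine ⟨fun x y => ?_, fun x y => ?_, fun x y => ?_⟩ <;>
    simp [Module.algebraMap_end_apply, smul_mul_assoc, mul_smul_comm]

/-- The multiplier algebra `M(R)` of a complex algebra `R` (possibly without unit). -/
def Multiplier : Type u := multiplierSubalgebra R

namespace Multiplier

noncomputable instance : Ring (Multiplier R) := inferInstanceAs (Ring (multiplierSubalgebra R))
noncomputable instance : Algebra ℂ (Multiplier R) :=
  inferInstanceAs (Algebra ℂ (multiplierSubalgebra R))

variable {R}

/-- Left multiplication `x ↦ m x`. -/
def left (m : Multiplier R) : R →ₗ[ℂ] R := m.1.1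

/-- Right multiplication `x ↦ x m`. -/
def right (m : Multiplier R) : R →ₗ[ℂ] R := m.1.2.unop

/-- The multiplier with given left and right multiplication. -/
def mk (l r : R →ₗ[ℂ] R) (hl : ∀ x y, l (x * y) = l x * y)
    (hr : ∀ x y, r (x * y) = x * r y) (h : ∀ x y, x * l y = r x * y) : Multiplier R :=
  ⟨(l, MulOpposite.op r), hl, hr, h⟩

theorem left_mul_apply (m : Multiplier R) (x y : R) : m.left (x * y) = m.left x * y := m.2.1 x y

theorem right_mul_apply (m : Multiplier R) (x y : R) : m.right (x * y) = x * m.right y :=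
  m.2.2.1 x y

theorem mul_left_apply (m : Multiplier R) (x y : R) : x * m.left y = m.right x * y := m.2.2.2 x y

theorem ext {m n : Multiplier R} (hl : ∀ x, m.left x = n.left x)
    (hr : ∀ x, m.right x = n.right x) : m = n :=
  Subtype.ext (Prod.ext (LinearMap.ext hl) (MulOpposite.unop_injective (LinearMap.ext hr)))

@[simp] theorem left_mk (l r : R →ₗ[ℂ] R) (hl hr h) : (mk l r hl hr h).left = l := rfl
@[simp] theorem right_mk (l r : R →ₗ[ℂ] R) (hl hr h) : (mk l r hl hr h).right = r := rfl
@[simp] theorem left_add (m n : Multiplier R) (x : R) :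
    (m + n).left x = m.left x + n.left x := rfl
@[simp] theorem right_add (m n : Multiplier R) (x : R) :
    (m + n).right x = m.right x + n.right x := rfl
@[simp] theorem left_mul (m n : Multiplier R) (x : R) :
    (m * n).left x = m.left (n.left x) := rfl
@[simp] theorem right_mul (m n : Multiplier R) (x : R) :
    (m * n).right x = n.right (m.right x) := rfl
@[simp] theorem left_smul (c : ℂ) (m : Multiplier R) (x : R) :
    (c • m).left x = c • m.left x := rfl
@[simp] theorem right_smul (c : ℂ) (m : Multiplier R) (x : R) :
    (c • m).right x = c • m.right x := rfl
@[simp] theorem left_zero (x : R) : (0 : Multiplier R).left x = 0 := rfl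
@[simp] theorem right_zero (x : R) : (0 : Multiplier R).right x = 0 := rfl

/-- An element of `R`, seen as a multiplier. -/
noncomputable def coe (x : R) : Multiplier R :=
  mk (LinearMap.mulLeft ℂ x) (LinearMap.mulRight ℂ x) (fun y z => by simp [mul_assoc])
    (fun y z => by simp [mul_assoc]) (fun y z => by simp [mul_assoc])

variable [StarRing R] [StarModule ℂ R]

/-- The linear map `x ↦ f(x*)*`. -/
def conjMap (f : R →ₗ[ℂ] R) : R →ₗ[ℂ] R where
  toFun x := star (f (star x))
  map_add' := by simp
  map_smul' := by simp

/-- The adjoint `m*` of a multiplier: `m* x = (x* m)*` and `x m* = (m x*)*`. -/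
instance : Star (Multiplier R) where
  star m := mk (conjMap m.right) (conjMap m.left)
    (fun x y => by simp [conjMap, right_mul_apply])
    (fun x y => by simp [conjMap, left_mul_apply])
    (fun x y => by
      have := congrArg star (m.mul_left_apply (star y) (star x))
      simpa [conjMap] using this.symm)

@[simp] theorem left_star (m : Multiplier R) (x : R) :
    (star m).left x = star (m.right (star x)) := rfl
@[simp] theorem right_star (m : Multiplier R) (x : R) :
    (star m).right x = star (m.left (star x)) := rfl

instance : StarRing (Multiplier R) where
  star_involutive m := ext (by simp) (by simp)
  star_mul m n := ext (by simp) (by simp)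
  star_add m n := ext (by simp) (by simp)

instance : StarModule ℂ (Multiplier R) where
  star_smul c m := ext (by simp) (by simp)

end Multiplier
end Multiplier

section MultiplierHopf

variable {A : Type u} [NonUnitalRing A] [Module ℂ A] [IsScalarTower ℂ A A] [SMulCommClass ℂ A A]

/-- The multiplier `m ⊗ n` of `A ⊗ A`. -/
noncomputable def Multiplier.tmul (m n : Multiplier A) : Multiplier (A ⊗[ℂ] A) :=
  have ind : ∀ f g : A ⊗[ℂ] A →ₗ[ℂ] A ⊗[ℂ] A →ₗ[ℂ] A ⊗[ℂ] A,
      (∀ a b c d, f (a ⊗ₜ b) (c ⊗ₜ d) = g (a ⊗ₜ b) (c ⊗ₜ d)) → ∀ x y, f x y = g x y := by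
    intro f g h x y
    have : f = g := TensorProduct.ext' fun a b => TensorProduct.ext' fun c d => h a b c d
    rw [this]
  Multiplier.mk (TensorProduct.map m.left n.left) (TensorProduct.map m.right n.right)
    (ind ((LinearMap.mul ℂ (A ⊗[ℂ] A)).compr₂ (TensorProduct.map m.left n.left))
      (LinearMap.mul ℂ (A ⊗[ℂ] A) ∘ₗ TensorProduct.map m.left n.left)
      (fun a b c d => by simp [Multiplier.left_mul_apply]))
    (ind ((LinearMap.mul ℂ (A ⊗[ℂ] A)).compr₂ (TensorProduct.map m.right n.right))
      ((LinearMap.mul ℂ (A ⊗[ℂ] A)).compl₂ (TensorProduct.map m.right n.right))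
      (fun a b c d => by simp [Multiplier.right_mul_apply]))
    (ind ((LinearMap.mul ℂ (A ⊗[ℂ] A)).compl₂ (TensorProduct.map m.left n.left))
      (LinearMap.mul ℂ (A ⊗[ℂ] A) ∘ₗ TensorProduct.map m.right n.right)
      (fun a b c d => by simp [Multiplier.mul_left_apply]))

/-- The multiplier `1 ⊗ a` of `A ⊗ A`. -/
noncomputable def oneTmul (a : A) : Multiplier (A ⊗[ℂ] A) :=
  Multiplier.tmul 1 (Multiplier.coe a)

/-- The multiplier `a ⊗ 1` of `A ⊗ A`. -/
noncomputable def tmulOne (a : A) : Multiplier (A ⊗[ℂ] A) :=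
  Multiplier.tmul (Multiplier.coe a) 1

variable [StarRing A] [StarModule ℂ A]

/-- `(A, Δ)` is a multiplier Hopf `*`-algebra: the product of `A` is non-degenerate, the elements
`Δ(a)(1 ⊗ b)` and `(a ⊗ 1)Δ(b)` of `M(A ⊗ A)` lie in `A ⊗ A`, the maps
`T₁(a ⊗ b) = Δ(a)(1 ⊗ b)` and `T₂(a ⊗ b) = (a ⊗ 1)Δ(b)` are bijections of `A ⊗ A`, and `Δ` is
coassociative, `(a ⊗ 1 ⊗ 1)(Δ ⊗ ι)(Δ(b)(1 ⊗ c)) = (ι ⊗ Δ)((a ⊗ 1)Δ(b))(1 ⊗ 1 ⊗ c)`, that is,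
`(T₂ ⊗ ι)(ι ⊗ T₁) = (ι ⊗ T₁)(T₂ ⊗ ι)` on `A ⊗ A ⊗ A`. -/
structure IsMultiplierHopfStarAlgebra (Δ : A →⋆ₙₐ[ℂ] Multiplier (A ⊗[ℂ] A)) : Prop where
  nondegenerate_left : ∀ a : A, (∀ b, a * b = 0) → a = 0
  nondegenerate_right : ∀ a : A, (∀ b, b * a = 0) → a = 0
  exists_canonical_maps : ∃ T₁ T₂ : (A ⊗[ℂ] A) ≃ₗ[ℂ] (A ⊗[ℂ] A),
    (∀ a b, Δ a * oneTmul b = Multiplier.coe (T₁ (a ⊗ₜ b))) ∧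
    (∀ a b, tmulOne a * Δ b = Multiplier.coe (T₂ (a ⊗ₜ b))) ∧
    (TensorProduct.assoc ℂ A A A).toLinearMap ∘ₗ T₂.toLinearMap.rTensor A ∘ₗ
        (TensorProduct.assoc ℂ A A A).symm.toLinearMap ∘ₗ T₁.toLinearMap.lTensor A =
      T₁.toLinearMap.lTensor A ∘ₗ (TensorProduct.assoc ℂ A A A).toLinearMap ∘ₗ
        T₂.toLinearMap.rTensor A ∘ₗ (TensorProduct.assoc ℂ A A A).symm.toLinearMap

/-- `ε` is the counit of `(A, Δ)`: `(ε ⊗ ι)Δ(a) = a` and `(ι ⊗ ε)Δ(a) = a`, where the first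
equation is multiplied by `1 ⊗ b` from the right and the second by `b ⊗ 1` from the left. -/
structure IsCounit (Δ : A →⋆ₙₐ[ℂ] Multiplier (A ⊗[ℂ] A)) (ε : A →ₗ[ℂ] ℂ) : Prop where
  left : ∀ (a b : A) (t : A ⊗[ℂ] A), Δ a * oneTmul b = Multiplier.coe t →
    TensorProduct.lid ℂ A (ε.rTensor A t) = a * b
  right : ∀ (a b : A) (t : A ⊗[ℂ] A), tmulOne b * Δ a = Multiplier.coe t →
    TensorProduct.rid ℂ A (ε.lTensor A t) = b * a

/-- `h` is a left cointegral: `h ≠ 0` and `a h = ε(a) h`. -/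
def IsLeftCointegral (ε : A →ₗ[ℂ] ℂ) (h : A) : Prop := h ≠ 0 ∧ ∀ a, a * h = ε a • h

/-- `h` is a right cointegral: `h ≠ 0` and `h a = ε(a) h`. -/
def IsRightCointegral (ε : A →ₗ[ℂ] ℂ) (h : A) : Prop := h ≠ 0 ∧ ∀ a, h * a = ε a • h

/-- `φ` is a left integral on `(A, Δ)`: it is nonzero and `(ι ⊗ φ)Δ(a) = φ(a) 1`, where the
equation is multiplied by `b ⊗ 1` from the left. -/
structure IsLeftIntegral (Δ : A →⋆ₙₐ[ℂ] Multiplier (A ⊗[ℂ] A)) (φ : A →ₗ[ℂ] ℂ) : Prop where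
  ne_zero : φ ≠ 0
  left_invariant : ∀ (a b : A) (t : A ⊗[ℂ] A), tmulOne b * Δ a = Multiplier.coe t →
    TensorProduct.rid ℂ A (φ.lTensor A t) = φ a • b

/-- The algebraic direct sum of the full matrix algebras `M_{n(i)}(ℂ)`, with componentwise
operations: families of matrices with finitely many nonzero members. -/
def matrixDirectSum {I : Type u} (n : I → ℕ) :
    NonUnitalStarSubalgebra ℂ (∀ i, Matrix (Fin (n i)) (Fin (n i)) ℂ) where
  carrier := {x | {i | x i ≠ 0}.Finite}
  add_mem' := by
    intro x y hx hy
    refine (Set.Finite.union hx hy).subset fun i hi => ?_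
    by_contra h
    simp only [Set.mem_union, Set.mem_ofPred_eq, not_or, not_not] at h
    exact hi (by simp [h.1, h.2])
  zero_mem' := by simp
  mul_mem' := by
    intro x y hx _
    exact Set.Finite.subset hx fun i hi h => hi (by simp [h])
  smul_mem' := by
    intro c x hx
    exact Set.Finite.subset hx fun i hi h => hi (by simp [h])
  star_mem' := by
    intro x hx
    exact Set.Finite.subset hx fun i hi h => hi (by simp [h])

variable (A) in
/-- The `*`-algebra `A` is a direct sum of full matrix algebras. -/
def IsDirectSumOfMatrixAlgebras : Prop :=
  ∃ (I : Type u) (n : I → ℕ), (∀ i, 0 < n i) ∧ Nonempty (A ≃⋆ₐ[ℂ] matrixDirectSum n)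

/-- A discrete quantum group: a multiplier Hopf `*`-algebra whose underlying `*`-algebra is a
direct sum of full matrix algebras. -/
structure IsDiscreteQuantumGroup (Δ : A →⋆ₙₐ[ℂ] Multiplier (A ⊗[ℂ] A)) : Prop where
  isDirectSum : IsDirectSumOfMatrixAlgebras A
  isMultiplierHopf : IsMultiplierHopfStarAlgebra Δ

end MultiplierHopf

open Coalgebra HopfAlgebra WithConv

/-- A Hopf `*`-algebra: a complex Hopf algebra with an involution for which the coproduct is a
`*`-homomorphism. -/
class IsHopfStarAlgebra (B : Type u) [Ring B] [HopfAlgebra ℂ B] [StarRing B] [StarModule ℂ B] :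
    Prop where
  comul_star : ∀ b : B, comul (R := ℂ) (star b) = star (comul (R := ℂ) b)

section HopfStar

variable {B : Type u} [Ring B] [HopfAlgebra ℂ B]

/-- In Sweedler notation, `F(x₁ ⊗ (x₂ ⊗ x₃))` may be computed by splitting either leg. -/
theorem sum_coassoc {M : Type*} [AddCommMonoid M] [Module ℂ M] (F : B ⊗[ℂ] (B ⊗[ℂ] B) →ₗ[ℂ] M)
    {ι : Type*} {x : B} (r : Coalgebra.Repr ℂ x ι) :
    ∑ i ∈ r.index, F (r.left i ⊗ₜ comul (r.right i)) =
      ∑ i ∈ r.index, F (TensorProduct.assoc ℂ B B B (comul (r.left i) ⊗ₜ r.right i)) := by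
  have h := Coalgebra.coassoc_apply (R := ℂ) x
  rw [← r.eq] at h
  simp only [map_sum, LinearMap.lTensor_tmul, LinearMap.rTensor_tmul] at h
  rw [← map_sum, ← h, map_sum]

theorem antipode_unique_right (f : B →ₗ[ℂ] B)
    (hf : ∀ x : B, LinearMap.mul' ℂ B (TensorProduct.map (antipode ℂ) f (comul x)) =
      algebraMap ℂ B (counit x)) (x : B) : f x = x := by
  have h1 : toConv (antipode ℂ (A := B)) * toConv f = 1 := by
    ext x; simpa using hf x
  have h2 : toConv (LinearMap.id (R := ℂ) (M := B)) * toConv (antipode ℂ (A := B)) = 1 :=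
    LinearMap.id_mul_antipode
  have := left_inv_eq_right_inv h2 h1
  exact (congrArg (fun g => g.ofConv x) this).symm


theorem sum_contract_left (K : B ⊗[ℂ] B →ₗ[ℂ] B)
    (hK : ∀ x : B, K (comul x) = algebraMap ℂ B (counit x)) {ι : Type*} {x : B}
    (r : Coalgebra.Repr ℂ x ι) :
    ∑ i ∈ r.index, K.rTensor B ((TensorProduct.assoc ℂ B B B).symm
      (r.left i ⊗ₜ comul (r.right i))) = (1 : B) ⊗ₜ[ℂ] x := by
  have h := sum_coassoc (K.rTensor B ∘ₗ (TensorProduct.assoc ℂ B B B).symm.toLinearMap) r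
  simp only [LinearMap.comp_apply, LinearEquiv.coe_coe, LinearEquiv.symm_apply_apply,
    LinearMap.rTensor_tmul, hK, Algebra.algebraMap_eq_smul_one, TensorProduct.smul_tmul] at h
  rw [h, ← TensorProduct.tmul_sum, Coalgebra.sum_counit_smul]

theorem sum_smul_counit {ι : Type*} {x : B} (r : Coalgebra.Repr ℂ x ι) :
    ∑ i ∈ r.index, counit (R := ℂ) (r.right i) • r.left i = x := by
  have := congrArg (TensorProduct.rid ℂ B) (Coalgebra.sum_tmul_counit_eq (R := ℂ) r)
  simpa only [map_sum, TensorProduct.rid_tmul, one_smul] using this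

theorem sum_contract_right (K : B ⊗[ℂ] B →ₗ[ℂ] B)
    (hK : ∀ x : B, K (comul x) = algebraMap ℂ B (counit x)) {ι : Type*} {x : B}
    (r : Coalgebra.Repr ℂ x ι) :
    ∑ i ∈ r.index, K.lTensor B (TensorProduct.assoc ℂ B B B
      (comul (r.left i) ⊗ₜ r.right i)) = x ⊗ₜ[ℂ] (1 : B) := by
  have h := sum_coassoc (K.lTensor B) r
  rw [← h]
  simp only [LinearMap.lTensor_tmul, hK, Algebra.algebraMap_eq_smul_one,
    ← TensorProduct.smul_tmul]
  rw [← TensorProduct.sum_tmul, sum_smul_counit]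

/-- `S(x₁) x₂ ⊗ x₃ = 1 ⊗ x` -/
theorem sum_antipode_left {ι : Type*} {x : B} (r : Coalgebra.Repr ℂ x ι) :
    ∑ i ∈ r.index, (antipode ℂ (r.left i) ⊗ₜ[ℂ] (1 : B)) * comul (r.right i) =
      (1 : B) ⊗ₜ[ℂ] x := by
  rw [← sum_contract_left (LinearMap.mul' ℂ B ∘ₗ (antipode ℂ).rTensor B)
    (fun x => HopfAlgebra.mul_antipode_rTensor_comul_apply x) r]
  refine Finset.sum_congr rfl fun i _ => ?_
  induction comul (R := ℂ) (r.right i) with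
  | zero => simp
  | add s t hs ht => simp only [mul_add, TensorProduct.tmul_add, map_add, hs, ht]
  | tmul s t => simp

/-- `x₁ ⊗ x₂ S(x₃) = x ⊗ 1` -/
theorem sum_antipode_right {ι : Type*} {x : B} (r : Coalgebra.Repr ℂ x ι) :
    ∑ i ∈ r.index, comul (r.left i) * ((1 : B) ⊗ₜ[ℂ] antipode ℂ (r.right i)) =
      x ⊗ₜ[ℂ] (1 : B) := by
  rw [← sum_contract_right (LinearMap.mul' ℂ B ∘ₗ (antipode ℂ).lTensor B)
    (fun x => HopfAlgebra.mul_antipode_lTensor_comul_apply x) r]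
  refine Finset.sum_congr rfl fun i _ => ?_
  induction comul (R := ℂ) (r.left i) with
  | zero => simp
  | add s t hs ht => simp only [add_mul, TensorProduct.add_tmul, map_add, hs, ht]
  | tmul s t => simp

/-- `S(x)₁ ⊗ S(x)₂ = S(x₂) ⊗ S(x₁)` -/
theorem comul_antipode (x : B) : comul (R := ℂ) (antipode ℂ x) =
    TensorProduct.map (antipode ℂ) (antipode ℂ) (TensorProduct.comm ℂ B B (comul x)) := by
  let G : B →ₗ[ℂ] B ⊗[ℂ] B := TensorProduct.map (antipode ℂ) (antipode ℂ) ∘ₗ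
    (TensorProduct.comm ℂ B B).toLinearMap ∘ₗ comul
  have h1 : toConv (comul (R := ℂ) (A := B)) * toConv (comul ∘ₗ antipode ℂ) = 1 :=
    LinearMap.comul_right_inv
  have h2 : toConv G * toConv (comul (R := ℂ) (A := B)) = 1 := by
    ext x
    let r := Coalgebra.Repr.arbitrary ℂ x
    -- `p ⊗ (q ⊗ s) ↦ (S q ⊗ S p) Δ(s)`
    let F : B ⊗[ℂ] (B ⊗[ℂ] B) →ₗ[ℂ] B ⊗[ℂ] B :=
      LinearMap.mul' ℂ (B ⊗[ℂ] B) ∘ₗ TensorProduct.map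
        (TensorProduct.map (antipode ℂ) (antipode ℂ) ∘ₗ (TensorProduct.comm ℂ B B).toLinearMap)
        comul ∘ₗ (TensorProduct.assoc ℂ B B B).symm.toLinearMap
    have hF : ∀ p y : B, F (p ⊗ₜ comul y) = (1 : B) ⊗ₜ (antipode ℂ p * y) := by
      intro p y
      let q := Coalgebra.Repr.arbitrary ℂ y
      have := congrArg (fun z => ((1 : B) ⊗ₜ[ℂ] antipode ℂ p) * z) (sum_antipode_left q)
      simp only [Algebra.TensorProduct.tmul_mul_tmul, mul_one, Finset.mul_sum, ← mul_assoc,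
        one_mul] at this
      rw [← this, ← q.eq]
      simp [F, TensorProduct.tmul_sum]
    have h := sum_coassoc F r
    simp only [hF] at h
    rw [← TensorProduct.tmul_sum, HopfAlgebra.sum_antipode_mul_eq_algebraMap_counit] at h
    rw [r.convMul_apply]
    simp only [LinearMap.convOne_apply, Algebra.TensorProduct.algebraMap_apply']
    rw [h]
    exact Finset.sum_congr rfl fun i _ => by simp [F, G]
  have := left_inv_eq_right_inv h2 h1
  exact (congrArg (fun g => g.ofConv x) this).symm

variable [StarRing B] [StarModule ℂ B] [IsHopfStarAlgebra B]

/-- `x ↦ S(x*)*`, the inverse of the antipode. -/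
noncomputable def antipodeInv : B →ₗ[ℂ] B where
  toFun x := star (antipode ℂ (star x))
  map_add' := by simp
  map_smul' := by simp

theorem antipodeInv_apply (x : B) : antipodeInv x = star (antipode ℂ (star x)) := rfl

theorem antipodeInv_mul (x y : B) : antipodeInv (x * y) = antipodeInv y * antipodeInv x := by
  simp [antipodeInv_apply, antipode_mul_antidistrib]

theorem antipodeInv_one : antipodeInv (1 : B) = 1 := by
  simp [antipodeInv_apply]

/-- The Sweedler sum for `x*`. -/
noncomputable def starRepr {ι : Type*} {x : B} (r : Coalgebra.Repr ℂ x ι) :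
    Coalgebra.Repr ℂ (star x) ι where
  index := r.index
  left i := star (r.left i)
  right i := star (r.right i)
  eq := by
    rw [IsHopfStarAlgebra.comul_star, ← r.eq, star_sum]
    simp

theorem counit_star (x : B) : counit (R := ℂ) (star x) = star (counit (R := ℂ) x) := by
  let r := Coalgebra.Repr.arbitrary ℂ x
  have h1 : ∑ i ∈ r.index, star (counit (R := ℂ) (star (r.left i))) • r.right i = x := by
    have := congrArg star (Coalgebra.sum_counit_smul (starRepr r))
    simpa [starRepr, star_sum] using this
  have h2 := sum_smul_counit r
  have h3 := congrArg (counit (R := ℂ)) h1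
  have h4 := congrArg (fun z => star (counit (R := ℂ) (star z))) h2
  simp only [map_sum, map_smul, star_sum, star_smul, smul_eq_mul] at h3 h4
  rw [← star_star (counit (R := ℂ) (star x)), ← h4, ← h3]
  congr 1
  exact Finset.sum_congr rfl fun i _ => by simp [mul_comm]

theorem sum_right_mul_antipodeInv_left {ι : Type*} {x : B} (r : Coalgebra.Repr ℂ x ι) :
    ∑ i ∈ r.index, r.right i * antipodeInv (r.left i) = algebraMap ℂ B (counit x) := by
  have := congrArg star (HopfAlgebra.sum_antipode_mul_eq_smul (starRepr r))
  simpa [starRepr, star_sum, counit_star, Algebra.algebraMap_eq_smul_one, antipodeInv_apply]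
    using this

theorem sum_antipodeInv_right_mul_left {ι : Type*} {x : B} (r : Coalgebra.Repr ℂ x ι) :
    ∑ i ∈ r.index, antipodeInv (r.right i) * r.left i = algebraMap ℂ B (counit x) := by
  have := congrArg star (HopfAlgebra.sum_mul_antipode_eq_smul (starRepr r))
  simpa [starRepr, star_sum, counit_star, Algebra.algebraMap_eq_smul_one, antipodeInv_apply]
    using this

theorem antipode_antipodeInv (x : B) : antipode ℂ (antipodeInv x) = x := by
  refine antipode_unique_right (antipode ℂ ∘ₗ antipodeInv) (fun x => ?_) x
  let r := Coalgebra.Repr.arbitrary ℂ x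
  have := congrArg (antipode ℂ) (sum_antipodeInv_right_mul_left r)
  rw [← r.eq]
  simpa [antipode_mul_antidistrib, Algebra.algebraMap_eq_smul_one, map_sum] using this

theorem antipodeInv_antipode (x : B) : antipodeInv (antipode ℂ x) = x := by
  have := congrArg star (antipode_antipodeInv (star x))
  simpa [antipodeInv_apply] using this

theorem star_antipode_star_antipode (x : B) : star (antipode ℂ (star (antipode ℂ x))) = x :=
  antipodeInv_antipode x

/-- `x₂ S⁻¹(x₁) ⊗ x₃ = 1 ⊗ x` -/
theorem sum_antipodeInv_left {ι : Type*} {x : B} (r : Coalgebra.Repr ℂ x ι) :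
    ∑ i ∈ r.index, comul (r.right i) * (antipodeInv (r.left i) ⊗ₜ[ℂ] (1 : B)) =
      (1 : B) ⊗ₜ[ℂ] x := by
  rw [← sum_contract_left (LinearMap.mul' ℂ B ∘ₗ (TensorProduct.comm ℂ B B).toLinearMap ∘ₗ
    antipodeInv.rTensor B) (fun x => by
      let q := Coalgebra.Repr.arbitrary ℂ x
      rw [← sum_right_mul_antipodeInv_left q, ← q.eq]; simp) r]
  refine Finset.sum_congr rfl fun i _ => ?_
  induction comul (R := ℂ) (r.right i) with
  | zero => simp
  | add s t hs ht => simp only [add_mul, TensorProduct.tmul_add, map_add, hs, ht]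
  | tmul s t => simp

/-- `x₁ ⊗ S⁻¹(x₃) x₂ = x ⊗ 1` -/
theorem sum_antipodeInv_right {ι : Type*} {x : B} (r : Coalgebra.Repr ℂ x ι) :
    ∑ i ∈ r.index, ((1 : B) ⊗ₜ[ℂ] antipodeInv (r.right i)) * comul (r.left i) =
      x ⊗ₜ[ℂ] (1 : B) := by
  rw [← sum_contract_right (LinearMap.mul' ℂ B ∘ₗ (TensorProduct.comm ℂ B B).toLinearMap ∘ₗ
    antipodeInv.lTensor B) (fun x => by
      let q := Coalgebra.Repr.arbitrary ℂ x
      rw [← sum_antipodeInv_right_mul_left q, ← q.eq]; simp) r]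
  refine Finset.sum_congr rfl fun i _ => ?_
  induction comul (R := ℂ) (r.left i) with
  | zero => simp
  | add s t hs ht => simp only [mul_add, TensorProduct.add_tmul, map_add, hs, ht]
  | tmul s t => simp

/-- The involution `ω*(x) = conj ω(S(x)*)` on linear functionals. -/
noncomputable def dualStar (ω : WithConv (B →ₗ[ℂ] ℂ)) : WithConv (B →ₗ[ℂ] ℂ) :=
  toConv
    { toFun := fun x => star (ω (star (antipode ℂ x)))
      map_add' := by simp
      map_smul' := by simp }

theorem dualStar_apply (ω : WithConv (B →ₗ[ℂ] ℂ)) (x : B) :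
    dualStar ω x = star (ω (star (antipode ℂ x))) := rfl

theorem dualStar_add (ω χ : WithConv (B →ₗ[ℂ] ℂ)) :
    dualStar (ω + χ) = dualStar ω + dualStar χ := by
  ext x; simp [dualStar]

theorem dualStar_smul (c : ℂ) (ω : WithConv (B →ₗ[ℂ] ℂ)) :
    dualStar (c • ω) = star c • dualStar ω := by
  ext x; simp [dualStar]

theorem dualStar_dualStar (ω : WithConv (B →ₗ[ℂ] ℂ)) : dualStar (dualStar ω) = ω := by
  ext x
  change star (star (ω (star (antipode ℂ (star (antipode ℂ x)))))) = ω x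
  rw [star_antipode_star_antipode, star_star]

theorem dualStar_mul (ω χ : WithConv (B →ₗ[ℂ] ℂ)) :
    dualStar (ω * χ) = dualStar χ * dualStar ω := by
  ext x
  let r := Coalgebra.Repr.arbitrary ℂ x
  rw [r.convMul_apply]
  change star (LinearMap.mul' ℂ ℂ (TensorProduct.map ω.ofConv χ.ofConv
    (comul (star (antipode ℂ x))))) = _
  rw [IsHopfStarAlgebra.comul_star, comul_antipode, ← r.eq]
  simp [dualStar, star_sum, mul_comm]

/-- The tensor product of a Hopf `*`-algebra with itself is a Hopf `*`-algebra. -/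
instance : IsHopfStarAlgebra (B ⊗[ℂ] B) where
  comul_star t := by
    induction t with
    | zero => simp
    | add s t hs ht => simp only [star_add, map_add, hs, ht]
    | tmul x y =>
      let r := Coalgebra.Repr.arbitrary ℂ x
      let q := Coalgebra.Repr.arbitrary ℂ y
      rw [TensorProduct.star_tmul, TensorProduct.comul_tmul, TensorProduct.comul_tmul,
        IsHopfStarAlgebra.comul_star, IsHopfStarAlgebra.comul_star, ← r.eq, ← q.eq]
      simp [TensorProduct.sum_tmul, TensorProduct.tmul_sum]

end HopfStar

variable {B : Type u} [Ring B] [HopfAlgebra ℂ B] [StarRing B] [StarModule ℂ B]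
  [IsHopfStarAlgebra B]

variable (B) in
/-- A positive integral on a Hopf `*`-algebra: a nonzero left invariant linear functional `φ` with
`φ(b* b) ≥ 0` for all `b`. -/
structure PositiveIntegral where
  toLinearMap : B →ₗ[ℂ] ℂ
  ne_zero : toLinearMap ≠ 0
  /-- `(ι ⊗ φ)Δ(b) = φ(b) 1` -/
  left_invariant : ∀ b : B,
    TensorProduct.rid ℂ B (toLinearMap.lTensor B (comul b)) = toLinearMap b • (1 : B)
  positive : ∀ b : B, 0 ≤ toLinearMap (star b * b)

namespace PositiveIntegral

instance : CoeFun (PositiveIntegral B) (fun _ => B → ℂ) where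
  coe φ := φ.toLinearMap

variable (φ : PositiveIntegral B)

theorem im_eq_zero (b : B) : (φ (star b * b)).im = 0 :=
  ((Complex.le_def.1 (φ.positive b)).2).symm

theorem re_nonneg (b : B) : 0 ≤ (φ (star b * b)).re := (Complex.le_def.1 (φ.positive b)).1

theorem apply_star (b : B) : φ (star b) = star (φ b) := by
  have h0 := φ.im_eq_zero 1
  have h1 := φ.im_eq_zero (1 + b)
  have h2 := φ.im_eq_zero (1 + Complex.I • b)
  have h3 := φ.im_eq_zero b
  simp only [star_add, star_one, star_smul, add_mul, mul_add, mul_one, one_mul, smul_mul_assoc,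
    mul_smul_comm, map_add, map_smul, smul_eq_mul, Complex.add_im, Complex.mul_im,
    Complex.mul_re] at h0 h1 h2
  simp at h0 h1 h2
  apply Complex.ext
  · simp; linarith
  · simp; linarith

theorem apply_one_ne_zero : φ 1 ≠ 0 := by
  intro h
  have key : ∀ b, (φ b).re = 0 := by
    intro b
    by_contra hb
    have h1 := φ.re_nonneg (((-((φ (star b * b)).re + 1) / (2 * (φ b).re) : ℝ) : ℂ) • 1 + b)
    have hs := congrArg Complex.re (φ.apply_star b)
    simp only [star_add, star_one, star_smul, add_mul, mul_add, mul_one, one_mul, smul_mul_assoc,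
      mul_smul_comm, map_add, map_smul, smul_eq_mul, h, mul_zero, Complex.add_re,
      Complex.re_ofReal_mul, Complex.star_def, Complex.conj_ofReal, hs, Complex.conj_re,
      Complex.zero_re] at h1
    have h2 : -((φ (star b * b)).re + 1) / (2 * (φ b).re) * (φ b).re =
      -((φ (star b * b)).re + 1) / 2 := by field_simp
    linarith
  refine φ.ne_zero (LinearMap.ext fun b => ?_)
  have h1 := key b
  have h2 := key (Complex.I • b)
  simp at h2
  exact Complex.ext (by simpa using h1) (by simpa using h2)

/-- `(ω ⊗ φ)(Δ(z)(p ⊗ 1)) = φ(z) ω(p)` -/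
theorem slice_left (ω : B →ₗ[ℂ] ℂ) (z p : B) :
    LinearMap.mul' ℂ ℂ (TensorProduct.map ω φ.toLinearMap (comul z * (p ⊗ₜ[ℂ] (1 : B)))) =
      φ z * ω p := by
  have h : ∀ t : B ⊗[ℂ] B,
      LinearMap.mul' ℂ ℂ (TensorProduct.map ω φ.toLinearMap (t * (p ⊗ₜ[ℂ] (1 : B)))) =
      ω (TensorProduct.rid ℂ B (φ.toLinearMap.lTensor B t) * p) := by
    intro t
    induction t with
    | zero => simp
    | add s t hs ht => simp only [add_mul, map_add, hs, ht]
    | tmul s t => simp [mul_comm]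
  rw [h, φ.left_invariant]
  simp

theorem apply_antipode (b : B) : φ (antipode ℂ b) = φ b := by
  let r := Coalgebra.Repr.arbitrary ℂ b
  -- right invariance of `φ ∘ S`
  have h1 : ∑ i ∈ r.index, φ (antipode ℂ (r.left i)) • r.right i = φ (antipode ℂ b) • (1 : B) := by
    have h := congrArg antipodeInv (φ.left_invariant (antipode ℂ b))
    rw [comul_antipode, ← r.eq] at h
    simpa [antipodeInv_antipode, antipodeInv_one] using h
  have h2 : ∑ i ∈ r.index, φ (r.right i) • r.left i = φ b • (1 : B) := by
    have h := φ.left_invariant b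
    rw [← r.eq] at h
    simpa using h
  have h3 := congrArg φ h1
  have h4 := congrArg (fun x => φ (antipode ℂ x)) h2
  simp only [map_sum, map_smul, smul_eq_mul, antipode_one] at h3 h4
  refine mul_right_cancel₀ φ.apply_one_ne_zero ?_
  rw [← h3, ← h4]
  exact Finset.sum_congr rfl fun i _ => mul_comm _ _

/-- `(φ ⊗ ι)Δ(b) = φ(b) 1` -/
theorem right_invariant (b : B) :
    TensorProduct.lid ℂ B (φ.toLinearMap.rTensor B (comul b)) = φ b • (1 : B) := by
  let r := Coalgebra.Repr.arbitrary ℂ b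
  have h := congrArg antipodeInv (φ.left_invariant (antipode ℂ b))
  rw [comul_antipode, ← r.eq] at h
  rw [← r.eq]
  simpa [antipodeInv_antipode, antipodeInv_one, apply_antipode] using h

/-- `(φ ⊗ ω)((1 ⊗ p)Δ(z)) = φ(z) ω(p)` -/
theorem slice_right (ω : B →ₗ[ℂ] ℂ) (z p : B) :
    LinearMap.mul' ℂ ℂ (TensorProduct.map φ.toLinearMap ω (((1 : B) ⊗ₜ[ℂ] p) * comul z)) =
      φ z * ω p := by
  have h : ∀ t : B ⊗[ℂ] B,
      LinearMap.mul' ℂ ℂ (TensorProduct.map φ.toLinearMap ω (((1 : B) ⊗ₜ[ℂ] p) * t)) =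
      ω (p * TensorProduct.lid ℂ B (φ.toLinearMap.rTensor B t)) := by
    intro t
    induction t with
    | zero => simp
    | add s t hs ht => simp only [mul_add, map_add, hs, ht]
    | tmul s t => simp
  rw [h, φ.right_invariant]
  simp

/-- `(φ ⊗ ω)(Δ(z)(1 ⊗ p)) = φ(z) ω(p)` -/
theorem slice_right' (ω : B →ₗ[ℂ] ℂ) (z p : B) :
    LinearMap.mul' ℂ ℂ (TensorProduct.map φ.toLinearMap ω (comul z * ((1 : B) ⊗ₜ[ℂ] p))) =
      φ z * ω p := by
  have h : ∀ t : B ⊗[ℂ] B,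
      LinearMap.mul' ℂ ℂ (TensorProduct.map φ.toLinearMap ω (t * ((1 : B) ⊗ₜ[ℂ] p))) =
      ω (TensorProduct.lid ℂ B (φ.toLinearMap.rTensor B t) * p) := by
    intro t
    induction t with
    | zero => simp
    | add s t hs ht => simp only [add_mul, map_add, hs, ht]
    | tmul s t => simp
  rw [h, φ.right_invariant]
  simp

/-- `ω(y₁) φ(y₂ c) = ω(S⁻¹(c₁)) φ(y c₂)` -/
theorem strong_left (ω : B →ₗ[ℂ] ℂ) (y : B) {ι : Type*} {c : B} (r : Coalgebra.Repr ℂ c ι) :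
    LinearMap.mul' ℂ ℂ (TensorProduct.map ω φ.toLinearMap (comul y * ((1 : B) ⊗ₜ[ℂ] c))) =
      ∑ i ∈ r.index, ω (antipodeInv (r.left i)) * φ (y * r.right i) := by
  rw [← sum_antipodeInv_left r, Finset.mul_sum, map_sum, map_sum]
  refine Finset.sum_congr rfl fun i _ => ?_
  rw [← mul_assoc, ← Bialgebra.comul_mul, slice_left, mul_comm]

/-- `φ(a y₁) ω(y₂) = φ(a₁ y) ω(S⁻¹(a₂))` -/
theorem strong_right (ω : B →ₗ[ℂ] ℂ) (y : B) {ι : Type*} {a : B} (r : Coalgebra.Repr ℂ a ι) :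
    LinearMap.mul' ℂ ℂ (TensorProduct.map φ.toLinearMap ω ((a ⊗ₜ[ℂ] (1 : B)) * comul y)) =
      ∑ i ∈ r.index, φ (r.left i * y) * ω (antipodeInv (r.right i)) := by
  rw [← sum_antipodeInv_right r, Finset.sum_mul, map_sum, map_sum]
  refine Finset.sum_congr rfl fun i _ => ?_
  rw [mul_assoc, ← Bialgebra.comul_mul, slice_right]

/-- `φ(y₁ a) ω(y₂) = φ(y a₁) ω(S(a₂))` -/
theorem strong_right' (ω : B →ₗ[ℂ] ℂ) (y : B) {ι : Type*} {a : B} (r : Coalgebra.Repr ℂ a ι) :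
    LinearMap.mul' ℂ ℂ (TensorProduct.map φ.toLinearMap ω (comul y * (a ⊗ₜ[ℂ] (1 : B)))) =
      ∑ i ∈ r.index, φ (y * r.left i) * ω (antipode ℂ (r.right i)) := by
  rw [← sum_antipode_right r, Finset.mul_sum, map_sum, map_sum]
  refine Finset.sum_congr rfl fun i _ => ?_
  rw [← mul_assoc, ← Bialgebra.comul_mul, slice_right']

theorem swap (a b y : B) {ι κ : Type*} (r : Coalgebra.Repr ℂ a ι) (q : Coalgebra.Repr ℂ b κ) :
    ∑ i ∈ r.index, φ (r.left i * y) * φ (antipodeInv (r.right i) * b) =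
      φ (y * ∑ j ∈ q.index, φ (a * antipodeInv (q.left j)) • q.right j) := by
  have h1 := φ.strong_left (φ.toLinearMap ∘ₗ LinearMap.mulLeft ℂ a) y q
  have h2 := φ.strong_right (φ.toLinearMap ∘ₗ LinearMap.mulRight ℂ b) y r
  have h3 : ∀ t : B ⊗[ℂ] B,
      LinearMap.mul' ℂ ℂ (TensorProduct.map (φ.toLinearMap ∘ₗ LinearMap.mulLeft ℂ a)
        φ.toLinearMap (t * ((1 : B) ⊗ₜ[ℂ] b))) =
      LinearMap.mul' ℂ ℂ (TensorProduct.map φ.toLinearMap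
        (φ.toLinearMap ∘ₗ LinearMap.mulRight ℂ b) ((a ⊗ₜ[ℂ] (1 : B)) * t)) := by
    intro t
    induction t with
    | zero => simp
    | add s t hs ht => simp only [add_mul, mul_add, map_add, hs, ht]
    | tmul s t => simp
  rw [h3, h2] at h1
  simpa [Finset.mul_sum] using h1

/-- Every functional `φ(p ·)` is of the form `φ(· c)`. -/
theorem exists_mul_right_eq (p : B) : ∃ c : B, ∀ x, φ (p * x) = φ (x * c) := by
  let r := Coalgebra.Repr.arbitrary ℂ p
  let q := fun i => Coalgebra.Repr.arbitrary ℂ (antipodeInv (antipodeInv (r.right i)))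
  refine ⟨(φ 1)⁻¹ • ∑ i ∈ r.index, ∑ j ∈ (q i).index,
    φ (r.left i * antipodeInv ((q i).left j)) • (q i).right j, fun x => ?_⟩
  -- `a ⊗ (b ⊗ c) ↦ φ(a x) φ(S⁻¹(b) S⁻²(c))`
  let F : B ⊗[ℂ] (B ⊗[ℂ] B) →ₗ[ℂ] ℂ := LinearMap.mul' ℂ ℂ ∘ₗ TensorProduct.map
    (φ.toLinearMap ∘ₗ LinearMap.mulRight ℂ x)
    (φ.toLinearMap ∘ₗ LinearMap.mul' ℂ B ∘ₗ
      TensorProduct.map antipodeInv (antipodeInv ∘ₗ antipodeInv))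
  have hF : ∀ a y : B, F (a ⊗ₜ comul y) = φ ((counit (R := ℂ) y • a) * x) * φ 1 := by
    intro a y
    let s := Coalgebra.Repr.arbitrary ℂ y
    have h := congrArg antipodeInv (sum_antipodeInv_right_mul_left s)
    rw [Algebra.algebraMap_eq_smul_one] at h
    simp only [map_sum, antipodeInv_mul, map_smul, antipodeInv_one] at h
    have h' : LinearMap.mul' ℂ B (TensorProduct.map antipodeInv (antipodeInv ∘ₗ antipodeInv)
        (comul y)) = counit (R := ℂ) y • (1 : B) := by
      rw [← h, ← s.eq]; simp
    simp only [F, LinearMap.comp_apply, TensorProduct.map_tmul, LinearMap.mul'_apply, h']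
    simp
    ring
  have h := sum_coassoc F r
  simp only [hF] at h
  rw [← Finset.sum_mul, ← map_sum, ← Finset.sum_mul, sum_smul_counit] at h
  rw [mul_smul_comm, map_smul, smul_eq_mul, Finset.mul_sum, map_sum,
    eq_inv_mul_iff_mul_eq₀ φ.apply_one_ne_zero, mul_comm, h]
  refine Finset.sum_congr rfl fun i _ => ?_
  let s := Coalgebra.Repr.arbitrary ℂ (r.left i)
  rw [← φ.swap (r.left i) _ x s (q i), ← s.eq]
  simp [F, TensorProduct.sum_tmul]

end PositiveIntegral

namespace PositiveIntegral
variable (φ : PositiveIntegral B)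

/-- The functional `φ(· b)`. -/
noncomputable def functional (b : B) : WithConv (B →ₗ[ℂ] ℂ) :=
  toConv (φ.toLinearMap ∘ₗ LinearMap.mulRight ℂ b)

theorem functional_apply (b x : B) : φ.functional b x = φ (x * b) := rfl

theorem mul_functional (ω : WithConv (B →ₗ[ℂ] ℂ)) {ι : Type*} {c : B}
    (r : Coalgebra.Repr ℂ c ι) :
    ω * φ.functional c = φ.functional (∑ i ∈ r.index, ω (antipodeInv (r.left i)) • r.right i) := by
  ext y
  have h := φ.strong_left ω.ofConv y r
  have h3 : ∀ t : B ⊗[ℂ] B,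
      LinearMap.mul' ℂ ℂ (TensorProduct.map ω.ofConv φ.toLinearMap (t * ((1 : B) ⊗ₜ[ℂ] c))) =
      LinearMap.mul' ℂ ℂ (TensorProduct.map ω.ofConv (φ.functional c).ofConv t) := by
    intro t
    induction t with
    | zero => simp
    | add s t hs ht => simp only [add_mul, map_add, hs, ht]
    | tmul s t => simp [functional]
  rw [LinearMap.convMul_apply, ← h3, h]
  simp [functional, Finset.mul_sum]

/-- The underlying algebra of the dual: the functionals `φ(· b)`, `b ∈ B`, with the convolution
product `⟨a a', y⟩ = ⟨a ⊗ a', Δ(y)⟩`. -/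
noncomputable def dualSubalgebra : NonUnitalSubalgebra ℂ (WithConv (B →ₗ[ℂ] ℂ)) where
  carrier := Set.range φ.functional
  add_mem' := by
    rintro _ _ ⟨b, rfl⟩ ⟨c, rfl⟩
    exact ⟨b + c, by ext x; simp [functional, mul_add]⟩
  zero_mem' := ⟨0, by ext x; simp [functional]⟩
  smul_mem' := by
    rintro c _ ⟨b, rfl⟩
    exact ⟨c • b, by ext x; simp [functional]⟩
  mul_mem' := by
    rintro _ _ ⟨b, rfl⟩ ⟨c, rfl⟩
    exact ⟨_, (φ.mul_functional _ (Coalgebra.Repr.arbitrary ℂ c)).symm⟩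

theorem functional_mem (b : B) : φ.functional b ∈ φ.dualSubalgebra := ⟨b, rfl⟩

theorem mul_mem_dualSubalgebra (ω : WithConv (B →ₗ[ℂ] ℂ)) {χ : WithConv (B →ₗ[ℂ] ℂ)}
    (h : χ ∈ φ.dualSubalgebra) : ω * χ ∈ φ.dualSubalgebra := by
  obtain ⟨c, rfl⟩ := h
  exact ⟨_, (φ.mul_functional _ (Coalgebra.Repr.arbitrary ℂ c)).symm⟩

theorem mulLeft_mem_dualSubalgebra (p : B) {χ : WithConv (B →ₗ[ℂ] ℂ)}
    (h : χ ∈ φ.dualSubalgebra) :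
    toConv (χ.ofConv ∘ₗ LinearMap.mulLeft ℂ p) ∈ φ.dualSubalgebra := by
  obtain ⟨b, rfl⟩ := h
  obtain ⟨c, hc⟩ := φ.exists_mul_right_eq p
  refine ⟨b * c, ?_⟩
  ext x
  simp [functional, mul_assoc, hc]

theorem dualStar_functional (b : B) :
    dualStar (φ.functional b) = φ.functional (antipodeInv (star b)) := by
  ext x
  change star (φ (star (antipode ℂ x) * b)) = φ (x * antipodeInv (star b))
  rw [← φ.apply_star, star_mul, star_star, ← φ.apply_antipode (x * _), antipode_mul_antidistrib,
    antipode_antipodeInv]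

/-- The underlying algebra of the dual of `(B, Δ)`: the functionals `φ(· b)` with `b ∈ B`. -/
def DualAlgebra : Type u := φ.dualSubalgebra

noncomputable instance : NonUnitalRing φ.DualAlgebra :=
  inferInstanceAs (NonUnitalRing φ.dualSubalgebra)
noncomputable instance : Module ℂ φ.DualAlgebra := inferInstanceAs (Module ℂ φ.dualSubalgebra)
instance : IsScalarTower ℂ φ.DualAlgebra φ.DualAlgebra :=
  inferInstanceAs (IsScalarTower ℂ φ.dualSubalgebra φ.dualSubalgebra)
instance : SMulCommClass ℂ φ.DualAlgebra φ.DualAlgebra :=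
  inferInstanceAs (SMulCommClass ℂ φ.dualSubalgebra φ.dualSubalgebra)

/-- The inclusion of the dual algebra in the full dual space with its convolution product. -/
noncomputable def incl : φ.DualAlgebra →ₗ[ℂ] WithConv (B →ₗ[ℂ] ℂ) := φ.dualSubalgebra.subtype

theorem incl_injective : Function.Injective φ.incl := Subtype.val_injective

theorem incl_mul (a b : φ.DualAlgebra) : φ.incl (a * b) = φ.incl a * φ.incl b := rfl

theorem incl_mem (a : φ.DualAlgebra) : φ.incl a ∈ φ.dualSubalgebra := a.2

/-- The pairing `⟨a, b⟩` between the dual and `B`. -/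
noncomputable def pairing (a : φ.DualAlgebra) (b : B) : ℂ := (φ.incl a).ofConv b

/-- The involution on the dual: `⟨a*, b⟩ = conj ⟨a, S(b)*⟩`. -/
noncomputable instance : Star φ.DualAlgebra where
  star a := ⟨dualStar (φ.incl a), by
    obtain ⟨_, b, rfl⟩ := a
    exact ⟨antipodeInv (star b), (φ.dualStar_functional b).symm⟩⟩

theorem incl_star (a : φ.DualAlgebra) : φ.incl (star a) = dualStar (φ.incl a) := rfl

noncomputable instance : StarRing φ.DualAlgebra where
  star_involutive a := φ.incl_injective (by simp only [incl_star, dualStar_dualStar])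
  star_mul a b := φ.incl_injective (by simp only [incl_star, incl_mul, dualStar_mul])
  star_add a b := φ.incl_injective (by simp only [incl_star, map_add, dualStar_add])

instance : StarModule ℂ φ.DualAlgebra where
  star_smul c a := φ.incl_injective (by simp only [incl_star, map_smul, dualStar_smul])

/-- The element `φ(· b)` of the dual. -/
noncomputable def elem (b : B) : φ.DualAlgebra := ⟨φ.functional b, φ.functional_mem b⟩

theorem pairing_elem (b x : B) : φ.pairing (φ.elem b) x = φ (x * b) := rfl

/-- The pairing `⟨a ⊗ a', b ⊗ b'⟩ = ⟨a, b⟩⟨a', b'⟩`. -/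
noncomputable def tensorIncl :
    φ.DualAlgebra ⊗[ℂ] φ.DualAlgebra →ₗ[ℂ] WithConv (B ⊗[ℂ] B →ₗ[ℂ] ℂ) :=
  (WithConv.linearEquiv ℂ (B ⊗[ℂ] B →ₗ[ℂ] ℂ)).symm.toLinearMap ∘ₗ
    TensorProduct.dualDistrib ℂ B B ∘ₗ
    TensorProduct.map ((WithConv.linearEquiv ℂ (B →ₗ[ℂ] ℂ)).toLinearMap ∘ₗ φ.incl)
      ((WithConv.linearEquiv ℂ (B →ₗ[ℂ] ℂ)).toLinearMap ∘ₗ φ.incl)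

theorem tensorIncl_tmul_apply (a a' : φ.DualAlgebra) (b b' : B) :
    φ.tensorIncl (a ⊗ₜ a') (b ⊗ₜ b') = φ.pairing a b * φ.pairing a' b' := rfl

theorem tensorIncl_injective : Function.Injective φ.tensorIncl := by
  classical
  rw [← LinearMap.ker_eq_bot, LinearMap.ker_eq_bot']
  intro t ht
  let e := Module.Basis.ofVectorSpace ℂ φ.DualAlgebra
  let c := TensorProduct.equivFinsuppOfBasisLeft (N := φ.DualAlgebra) e t
  have hc : t = c.sum fun i m => e i ⊗ₜ m := by
    rw [← TensorProduct.equivFinsuppOfBasisLeft_symm_apply e c]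
    exact (LinearEquiv.symm_apply_apply _ t).symm
  suffices h : ∀ i, c i = 0 by
    rw [hc, Finsupp.sum]
    exact Finset.sum_eq_zero fun i _ => by rw [h i, TensorProduct.tmul_zero]
  intro i
  by_contra hi
  apply hi
  apply φ.incl_injective
  ext y
  have h0 : ∑ k ∈ c.support, φ.pairing (c k) y • e k = 0 := by
    apply φ.incl_injective
    ext x
    have := congrArg (fun g => g.ofConv (x ⊗ₜ y)) ht
    simp only [hc, Finsupp.sum, map_sum, WithConv.ofConv_sum, LinearMap.sum_apply,
      tensorIncl_tmul_apply] at this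
    simp only [map_sum, map_smul, WithConv.ofConv_sum, WithConv.ofConv_smul, LinearMap.sum_apply,
      LinearMap.smul_apply, smul_eq_mul]
    simpa [mul_comm, pairing] using this
  have := linearIndependent_iff'.1 e.linearIndependent c.support (fun k => φ.pairing (c k) y) h0 i
    (Finsupp.mem_support_iff.2 hi)
  simpa [pairing] using this

theorem tensorIncl_mul (s t : φ.DualAlgebra ⊗[ℂ] φ.DualAlgebra) :
    φ.tensorIncl (s * t) = φ.tensorIncl s * φ.tensorIncl t := by
  induction s with
  | zero => simp
  | add s s' hs hs' => simp only [add_mul, map_add, hs, hs']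
  | tmul a a' =>
    induction t with
    | zero => simp
    | add t t' ht ht' => simp only [mul_add, map_add, ht, ht']
    | tmul b b' =>
      rw [Algebra.TensorProduct.tmul_mul_tmul]
      ext x y
      let r := Coalgebra.Repr.arbitrary ℂ x
      let q := Coalgebra.Repr.arbitrary ℂ y
      change φ.pairing (a * b) x * φ.pairing (a' * b') y = _
      have h1 : φ.pairing (a * b) x = _ := r.convMul_apply _ _
      have h2 : φ.pairing (a' * b') y = _ := q.convMul_apply _ _
      have h3 := (r.tmul q).convMul_apply (φ.tensorIncl (a ⊗ₜ a')) (φ.tensorIncl (b ⊗ₜ b'))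
      refine Eq.trans ?_ h3.symm
      rw [h1, h2, Finset.sum_mul_sum]
      simp only [Coalgebra.Repr.tmul, Finset.sum_product]
      refine Finset.sum_congr rfl fun i _ => Finset.sum_congr rfl fun j _ => ?_
      exact mul_mul_mul_comm _ _ _ _

theorem tensorIncl_star (t : φ.DualAlgebra ⊗[ℂ] φ.DualAlgebra) :
    φ.tensorIncl (star t) = dualStar (φ.tensorIncl t) := by
  induction t with
  | zero => ext; simp [dualStar]
  | add s t hs ht => simp only [star_add, map_add, hs, ht, dualStar_add]
  | tmul a a' =>
    ext x y
    change star (φ.pairing a (star (antipode ℂ x))) * star (φ.pairing a' (star (antipode ℂ y))) =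
      star (φ.pairing a (star (antipode ℂ x)) * φ.pairing a' (star (antipode ℂ y)))
    simp

/-- The functional `x ⊗ y ↦ ⟨a, y x⟩` on `B ⊗ B`. -/
noncomputable def comulFunctional : φ.DualAlgebra →ₗ[ℂ] WithConv (B ⊗[ℂ] B →ₗ[ℂ] ℂ) :=
  (WithConv.linearEquiv ℂ (B ⊗[ℂ] B →ₗ[ℂ] ℂ)).symm.toLinearMap ∘ₗ
    (LinearMap.lcomp ℂ ℂ (LinearMap.mul' ℂ B ∘ₗ (TensorProduct.comm ℂ B B).toLinearMap)) ∘ₗ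
    (WithConv.linearEquiv ℂ (B →ₗ[ℂ] ℂ)).toLinearMap ∘ₗ φ.incl

theorem comulFunctional_tmul (a : φ.DualAlgebra) (x y : B) :
    φ.comulFunctional a (x ⊗ₜ y) = φ.pairing a (y * x) := rfl

theorem comulFunctional_mul (a b : φ.DualAlgebra) :
    φ.comulFunctional (a * b) = φ.comulFunctional a * φ.comulFunctional b := by
  ext x y
  let r := Coalgebra.Repr.arbitrary ℂ x
  let q := Coalgebra.Repr.arbitrary ℂ y
  let p : Coalgebra.Repr ℂ (y * x) ((B × B) × (B × B)) :=
    { index := q.index ×ˢ r.index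
      left := fun i => q.left i.1 * r.left i.2
      right := fun i => q.right i.1 * r.right i.2
      eq := by
        rw [Bialgebra.comul_mul, ← q.eq, ← r.eq, Finset.sum_mul_sum, Finset.sum_product]
        simp }
  have h1 : φ.pairing (a * b) (y * x) = _ := p.convMul_apply _ _
  have h3 := (r.tmul q).convMul_apply (φ.comulFunctional a) (φ.comulFunctional b)
  refine Eq.trans ?_ h3.symm
  change φ.pairing (a * b) (y * x) = _
  rw [h1]
  simp only [Coalgebra.Repr.tmul, p, Finset.sum_product]
  rw [Finset.sum_comm]
  rfl

theorem comulFunctional_star (a : φ.DualAlgebra) :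
    φ.comulFunctional (star a) = dualStar (φ.comulFunctional a) := by
  ext x y
  change star (φ.pairing a (star (antipode ℂ (y * x)))) =
    star (φ.pairing a (star (antipode ℂ y) * star (antipode ℂ x)))
  rw [antipode_mul_antidistrib, star_mul]

theorem comulFunctional_mul_mem (a : φ.DualAlgebra) (t : φ.DualAlgebra ⊗[ℂ] φ.DualAlgebra) :
    φ.comulFunctional a * φ.tensorIncl t ∈ LinearMap.range φ.tensorIncl := by
  induction t with
  | zero => simp
  | add s t hs ht => simpa only [map_add, mul_add] using add_mem hs ht
  | tmul c d =>
    obtain ⟨_, e, rfl⟩ := d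
    let s := Coalgebra.Repr.arbitrary ℂ e
    refine ⟨∑ k ∈ s.index,
      (⟨toConv ((φ.incl a).ofConv ∘ₗ LinearMap.mulLeft ℂ (antipodeInv (s.left k))),
        φ.mulLeft_mem_dualSubalgebra _ (φ.incl_mem a)⟩ * c : φ.DualAlgebra) ⊗ₜ
          φ.elem (s.right k), ?_⟩
    ext x y
    let r := Coalgebra.Repr.arbitrary ℂ x
    let q := Coalgebra.Repr.arbitrary ℂ y
    have h3 := (r.tmul q).convMul_apply (φ.comulFunctional a) (φ.tensorIncl (c ⊗ₜ φ.elem e))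
    refine Eq.trans ?_ h3.symm
    simp only [Coalgebra.Repr.tmul, Finset.sum_product, map_sum, WithConv.ofConv_sum,
      LinearMap.sum_apply, TensorProduct.AlgebraTensorModule.curry_apply,
      LinearMap.restrictScalars_self, TensorProduct.curry_apply, tensorIncl_tmul_apply,
      comulFunctional_tmul, pairing_elem]
    have h4 : ∀ i, ∑ j ∈ q.index, φ.pairing a (q.left j * r.left i) *
        (φ.pairing c (r.right i) * φ (q.right j * e)) =
        ∑ k ∈ s.index, φ.pairing a (antipodeInv (s.left k) * r.left i) * φ.pairing c (r.right i) *
          φ (y * s.right k) := by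
      intro i
      have h := φ.strong_left ((φ.incl a).ofConv ∘ₗ LinearMap.mulRight ℂ (r.left i)) y s
      rw [← q.eq] at h
      have h' := congrArg (fun z => φ.pairing c (r.right i) * z) h
      simp only [Finset.sum_mul, map_sum, Finset.mul_sum] at h'
      simp only [Algebra.TensorProduct.tmul_mul_tmul, mul_one, TensorProduct.map_tmul,
        LinearMap.mul'_apply, LinearMap.comp_apply, LinearMap.mulRight_apply] at h'
      refine Eq.trans (Finset.sum_congr rfl fun j _ => ?_)
        (h'.trans (Finset.sum_congr rfl fun k _ => ?_))
      · simp only [pairing]; ring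
      · simp only [pairing]; ring
    simp only [h4]
    rw [Finset.sum_comm]
    refine Finset.sum_congr rfl fun k _ => ?_
    rw [← Finset.sum_mul]
    congr 1
    exact r.convMul_apply _ _

theorem mul_comulFunctional_mem (a : φ.DualAlgebra) (t : φ.DualAlgebra ⊗[ℂ] φ.DualAlgebra) :
    φ.tensorIncl t * φ.comulFunctional a ∈ LinearMap.range φ.tensorIncl := by
  obtain ⟨s, hs⟩ := φ.comulFunctional_mul_mem (star a) (star t)
  refine ⟨star s, ?_⟩
  rw [tensorIncl_star, hs, dualStar_mul, comulFunctional_star, tensorIncl_star, dualStar_dualStar,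
    dualStar_dualStar]

/-- Left multiplication by `Δ(a)` on `A ⊗ A`. -/
noncomputable def comulLeft (a : φ.DualAlgebra) :
    φ.DualAlgebra ⊗[ℂ] φ.DualAlgebra →ₗ[ℂ] φ.DualAlgebra ⊗[ℂ] φ.DualAlgebra :=
  (LinearEquiv.ofInjective φ.tensorIncl φ.tensorIncl_injective).symm.toLinearMap ∘ₗ
    LinearMap.codRestrict (LinearMap.range φ.tensorIncl)
      (LinearMap.mulLeft ℂ (φ.comulFunctional a) ∘ₗ φ.tensorIncl) (φ.comulFunctional_mul_mem a)

/-- Right multiplication by `Δ(a)` on `A ⊗ A`. -/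
noncomputable def comulRight (a : φ.DualAlgebra) :
    φ.DualAlgebra ⊗[ℂ] φ.DualAlgebra →ₗ[ℂ] φ.DualAlgebra ⊗[ℂ] φ.DualAlgebra :=
  (LinearEquiv.ofInjective φ.tensorIncl φ.tensorIncl_injective).symm.toLinearMap ∘ₗ
    LinearMap.codRestrict (LinearMap.range φ.tensorIncl)
      (LinearMap.mulRight ℂ (φ.comulFunctional a) ∘ₗ φ.tensorIncl) (φ.mul_comulFunctional_mem a)

theorem tensorIncl_comulLeft (a : φ.DualAlgebra) (t : φ.DualAlgebra ⊗[ℂ] φ.DualAlgebra) :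
    φ.tensorIncl (φ.comulLeft a t) = φ.comulFunctional a * φ.tensorIncl t := by
  have := congrArg Subtype.val
    ((LinearEquiv.ofInjective φ.tensorIncl φ.tensorIncl_injective).apply_symm_apply
      ⟨φ.comulFunctional a * φ.tensorIncl t, φ.comulFunctional_mul_mem a t⟩)
  exact this

theorem tensorIncl_comulRight (a : φ.DualAlgebra) (t : φ.DualAlgebra ⊗[ℂ] φ.DualAlgebra) :
    φ.tensorIncl (φ.comulRight a t) = φ.tensorIncl t * φ.comulFunctional a := by
  have := congrArg Subtype.val
    ((LinearEquiv.ofInjective φ.tensorIncl φ.tensorIncl_injective).apply_symm_apply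
      ⟨φ.tensorIncl t * φ.comulFunctional a, φ.mul_comulFunctional_mem a t⟩)
  exact this

/-- The coproduct on the dual. Under the pairing with `B ⊗ B`, the multiplier `Δ(a)` is the
functional `⟨Δ(a), x ⊗ y⟩ = ⟨a, y x⟩`: its products with elements of `A ⊗ A` are the products with
that functional in the convolution algebra of functionals on `B ⊗ B`. -/
noncomputable def dualComul :
    φ.DualAlgebra →⋆ₙₐ[ℂ] Multiplier (φ.DualAlgebra ⊗[ℂ] φ.DualAlgebra) where
  toFun a := Multiplier.mk (φ.comulLeft a) (φ.comulRight a)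
    (fun x y => φ.tensorIncl_injective (by
      simp only [tensorIncl_comulLeft, tensorIncl_mul, mul_assoc]))
    (fun x y => φ.tensorIncl_injective (by
      simp only [tensorIncl_comulRight, tensorIncl_mul, mul_assoc]))
    (fun x y => φ.tensorIncl_injective (by
      simp only [tensorIncl_comulLeft, tensorIncl_comulRight, tensorIncl_mul, mul_assoc]))
  map_smul' c a := Multiplier.ext
    (fun t => φ.tensorIncl_injective (by
      simp [tensorIncl_comulLeft]))
    (fun t => φ.tensorIncl_injective (by
      simp [tensorIncl_comulRight]))
  map_zero' := Multiplier.ext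
    (fun t => φ.tensorIncl_injective (by simp [tensorIncl_comulLeft]))
    (fun t => φ.tensorIncl_injective (by simp [tensorIncl_comulRight]))
  map_add' a b := Multiplier.ext
    (fun t => φ.tensorIncl_injective (by simp [tensorIncl_comulLeft, add_mul]))
    (fun t => φ.tensorIncl_injective (by simp [tensorIncl_comulRight, mul_add]))
  map_mul' a b := Multiplier.ext
    (fun t => φ.tensorIncl_injective (by
      simp [tensorIncl_comulLeft, comulFunctional_mul, mul_assoc]))
    (fun t => φ.tensorIncl_injective (by
      simp [tensorIncl_comulRight, comulFunctional_mul, mul_assoc]))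
  map_star' a := Multiplier.ext
    (fun t => φ.tensorIncl_injective (by
      simp [tensorIncl_comulLeft, tensorIncl_comulRight, comulFunctional_star, tensorIncl_star,
        dualStar_mul, dualStar_dualStar]))
    (fun t => φ.tensorIncl_injective (by
      simp [tensorIncl_comulLeft, tensorIncl_comulRight, comulFunctional_star, tensorIncl_star,
        dualStar_mul, dualStar_dualStar]))

/-- Evaluation at `1`. -/
noncomputable def dualCounit : φ.DualAlgebra →ₗ[ℂ] ℂ :=
  LinearMap.applyₗ (1 : B) ∘ₗ (WithConv.linearEquiv ℂ (B →ₗ[ℂ] ℂ)).toLinearMap ∘ₗ φ.incl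

theorem dualCounit_apply (a : φ.DualAlgebra) : φ.dualCounit a = φ.pairing a 1 := rfl

end PositiveIntegral

end QuantumGroup

/-!
Let `A` be the dual of `(B, Δ)`, the functionals `φ(· b)` under convolution.

*Faithfulness.* The kernel of `b ↦ φ(· b)` is a left coideal on which `φ(1) ε(c) = φ(S(c₁) c₂)`
vanishes, and this forces it to be zero (`PositiveIntegral.functional_injective`). Hence
`b ↦ φ(· b)` identifies `B` with `A`, the functional `φ_A(φ(· b)) = ε(b)` is well defined, and strong
left invariance gives `ω φ(· b) = ω(S⁻¹(b₁)) φ(· b₂)`. Taking `ω = φ(· b)*` and applying `φ_A` yields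
the Plancherel formula `φ_A(a* a) = φ(b* b)` (`PositiveIntegral.dualIntegral_star_mul_self`); by the
Cauchy-Schwarz inequality `φ_A` is positive definite. The same formula shows that every principal
left ideal `A a` is finite-dimensional.

*Matrix algebras.* These two facts determine the structure of any `*`-algebra
(`isDirectSumOfMatrixAlgebras_of_posDef`). By Brauer's lemma every nonzero `a` has `a q ≠ 0` for a
minimal projection `q`, that is, `q A q = ℂ q` (`exists_isMinimalProjection`). For such `q` the left
ideal `A q` is a finite-dimensional Hilbert space with `x* y = ⟨x, y⟩ q`, the algebra acts on it by a
`*`-representation, and `x y*` acts as a rank-one operator. Choosing one `q` in each class of the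
relation `p A q ≠ 0`, the representations on the spaces `A q` together form an isomorphism onto the
direct sum of the full matrix algebras: only finitely many of them see a given `a`, because they
contribute mutually orthogonal nonzero vectors to a finite-dimensional space.

*Multiplier Hopf structure.* Let `B` act on `A` by `⟨p ▷ a, x⟩ = ⟨a, x p⟩` and
`⟨a ◁ p, x⟩ = ⟨a, p x⟩`. Strong invariance gives
`Δ(a)(1 ⊗ φ(· e)) = a ◁ S⁻¹(e₁) ⊗ φ(· e₂)` and `(φ(· c) ⊗ 1)Δ(b) = φ(· c₁) ⊗ S(c₂) ▷ b`. Both maps have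
explicit inverses by the antipode axiom (`PositiveIntegral.twistLeftEquiv`,
`PositiveIntegral.twistRightEquiv`), they satisfy coassociativity because the two actions commute,
and applying `ε_A` or `φ_A` to one leg gives the counit property and left invariance.
-/

namespace QuantumGroup

set_option linter.unusedSectionVars false

/-! ### Algebras with finite-dimensional principal left ideals and a positive definite functional -/

section MatrixDecomposition

variable {A : Type u} [NonUnitalRing A] [Module ℂ A] [IsScalarTower ℂ A A] [SMulCommClass ℂ A A]
  [StarRing A] [StarModule ℂ A]

/-- A minimal projection: a nonzero self-adjoint idempotent `q` with `q A q = ℂ q`. -/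
structure IsMinimalProjection (q : A) : Prop where
  ne_zero : q ≠ 0
  star_eq : star q = q
  mul_self : q * q = q
  exists_smul : ∀ x, ∃ c : ℂ, q * x * q = c • q

/-- Below a nonzero finite-dimensional left ideal there is a minimal one. -/
theorem exists_minimal_leftIdeal (I : Submodule ℂ A) [FiniteDimensional ℂ I]
    (hI : ∀ x, ∀ y ∈ I, x * y ∈ I) (h0 : I ≠ ⊥) :
    ∃ J ≤ I, (∀ x, ∀ y ∈ J, x * y ∈ J) ∧ J ≠ ⊥ ∧
      ∀ K ≤ J, (∀ x, ∀ y ∈ K, x * y ∈ K) → K ≠ ⊥ → K = J := by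
  obtain ⟨J, ⟨hJI, hJ, hJ0⟩, hmin⟩ := WellFounded.has_min
    (measure (fun J : Submodule ℂ A => Module.finrank ℂ J)).wf
    {J | J ≤ I ∧ (∀ x, ∀ y ∈ J, x * y ∈ J) ∧ J ≠ ⊥} ⟨I, le_rfl, hI, h0⟩
  refine ⟨J, hJI, hJ, hJ0, fun K hKJ hK hK0 => ?_⟩
  have : FiniteDimensional ℂ J := Submodule.finiteDimensional_of_le hJI
  exact Submodule.eq_of_le_of_finrank_le hKJ (not_lt.1 (hmin K ⟨hKJ.trans hJI, hK, hK0⟩))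

/-- Brauer's lemma for a proper involution: a minimal nonzero left ideal contains an
idempotent `e` acting on it as a right unit, and `e A e = ℂ e`. -/
theorem exists_idempotent_of_minimal (hproper : ∀ a : A, star a * a = 0 → a = 0)
    (J : Submodule ℂ A) [FiniteDimensional ℂ J] (hJ : ∀ x, ∀ y ∈ J, x * y ∈ J) (h0 : J ≠ ⊥)
    (hmin : ∀ K ≤ J, (∀ x, ∀ y ∈ K, x * y ∈ K) → K ≠ ⊥ → K = J) :
    ∃ e ∈ J, e ≠ 0 ∧ e * e = e ∧ ∀ x, ∃ c : ℂ, e * x * e = c • e := by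
  obtain ⟨x, hx, hx0⟩ := Submodule.exists_mem_ne_zero_of_ne_bot h0
  obtain ⟨s, hs, hss⟩ : ∃ s ∈ J, s * s ≠ 0 := by
    refine ⟨star x * x, hJ _ _ hx, fun h => hx0 (hproper x (hproper _ ?_))⟩
    simpa [mul_assoc] using h
  -- right multiplication by `s` is injective and surjective on `J`
  have hinj : ∀ y ∈ J, y * s = 0 → y = 0 := by
    intro y hy hys
    by_contra hy0
    have := hmin (J ⊓ LinearMap.ker (LinearMap.mulRight ℂ s)) inf_le_left
      (fun x y hy => ⟨hJ _ _ hy.1, by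
        have : y * s = 0 := hy.2
        simp [mul_assoc, this]⟩)
      (fun h => hy0 (by simpa using h.le (show y ∈ _ from ⟨hy, hys⟩)))
    exact hss ((this.ge hs).2)
  have hsurj : ∃ e ∈ J, e * s = s := by
    have := hmin (J.map (LinearMap.mulRight ℂ s)) (by
        rintro _ ⟨y, -, rfl⟩; exact hJ _ _ hs)
      (by
        rintro x _ ⟨y, hy, rfl⟩
        exact ⟨x * y, hJ _ _ hy, by simp [mul_assoc]⟩)
      (fun h => hss (by simpa using h.le (show s * s ∈ _ from ⟨s, hs, rfl⟩)))
    exact this.ge hs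
  obtain ⟨e, he, hes⟩ := hsurj
  have hee : ∀ y ∈ J, y * e = y := fun y hy =>
    sub_eq_zero.1 (hinj _ (sub_mem (hJ _ _ he) hy) (by simp [sub_mul, mul_assoc, hes]))
  have he0 : e ≠ 0 := by
    rintro rfl
    exact hss (by rw [← hes]; simp)
  refine ⟨e, he, he0, hee e he, fun x => ?_⟩
  -- right multiplication by `e x e` commutes with the left action, so an eigenspace is all of `J`
  let R : Module.End ℂ J := ((LinearMap.mulRight ℂ (e * x * e)).domRestrict J).codRestrict J
    (fun y => by simpa [mul_assoc] using hJ _ _ (hJ _ _ (hJ _ _ he)))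
  have : Nontrivial J := ⟨⟨⟨e, he⟩, 0, fun h => he0 (congrArg Subtype.val h)⟩⟩
  obtain ⟨c, hc⟩ := Module.End.exists_eigenvalue R
  obtain ⟨v, hv⟩ := hc.exists_hasEigenvector
  have hv1 : (v : A) * (e * x * e) = c • (v : A) := congrArg Subtype.val hv.apply_eq_smul
  have hker : ∀ y, y ∈ LinearMap.ker (LinearMap.mulRight ℂ (e * x * e) - c • LinearMap.id) ↔
      y * (e * x * e) = c • y := fun y => by
    simp only [LinearMap.mem_ker, LinearMap.sub_apply, LinearMap.mulRight_apply,
      LinearMap.smul_apply, LinearMap.id_apply, sub_eq_zero]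
  have := hmin (J ⊓ LinearMap.ker (LinearMap.mulRight ℂ (e * x * e) - c • LinearMap.id))
    inf_le_left
    (fun z y hy => ⟨hJ _ _ hy.1, (hker _).2 (by
      rw [mul_assoc, (hker y).1 hy.2, mul_smul_comm])⟩)
    (fun h => hv.2 (Subtype.ext (by
      simpa using h.le (show (v : A) ∈ _ from ⟨v.2, (hker _).2 hv1⟩))))
  have h := (hker e).1 (this.ge he).2
  exact ⟨c, by rw [← h, ← mul_assoc, ← mul_assoc, hee e he]⟩

/-- With a proper involution, the idempotent of Brauer's lemma can be replaced by a self-adjoint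
one, and the minimal projections separate the points of `A`. -/
theorem exists_isMinimalProjection (hproper : ∀ a : A, star a * a = 0 → a = 0)
    (hfin : ∀ a : A, FiniteDimensional ℂ (LinearMap.range (LinearMap.mulRight ℂ a)))
    {a : A} (ha : a ≠ 0) : ∃ q : A, IsMinimalProjection q ∧ a * q ≠ 0 := by
  have := hfin a
  obtain ⟨J, hJI, hJ, hJ0, hmin⟩ := exists_minimal_leftIdeal
    (LinearMap.range (LinearMap.mulRight ℂ a))
    (by
      rintro x _ ⟨y, rfl⟩
      exact ⟨x * y, by simp [mul_assoc]⟩)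
    (fun h => ha (hproper a (by
      simpa using h.le (show star a * a ∈ _ from ⟨star a, rfl⟩))))
  have : FiniteDimensional ℂ J := Submodule.finiteDimensional_of_le hJI
  obtain ⟨e, he, he0, hee, hsc⟩ := exists_idempotent_of_minimal hproper J hJ hJ0 hmin
  -- `e e* e = c e`, so `c⁻¹ e* e` is a projection with the same left ideal as `e`
  obtain ⟨c, hc⟩ := hsc (star e)
  have hp0 : star e * e ≠ 0 := fun h => he0 (hproper e h)
  have hpp : (star e * e) * (star e * e) = c • (star e * e) := by
    rw [← mul_smul_comm, ← hc]; simp only [mul_assoc]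
  have hc0 : c ≠ 0 := by
    rintro rfl
    refine hp0 (hproper _ ?_)
    simpa using hpp
  have hcr : star c = c := by
    have h := congrArg star hpp
    simp only [star_mul, star_star, star_smul] at h
    rw [hpp] at h
    exact (smul_left_injective ℂ hp0 h).symm
  have hq : (c⁻¹ • (star e * e)) * (c⁻¹ • (star e * e)) = c⁻¹ • (star e * e) := by
    rw [smul_mul_smul_comm, hpp, smul_smul]
    congr 1
    field_simp
  have hq0 : c⁻¹ • (star e * e) ≠ 0 := smul_ne_zero (inv_ne_zero hc0) hp0
  refine ⟨c⁻¹ • (star e * e), ⟨hq0, ?_, hq, fun x => ?_⟩, fun h => ?_⟩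
  · rw [star_smul, star_inv₀, hcr, star_mul, star_star]
  · obtain ⟨d, hd⟩ := hsc (x * star e)
    refine ⟨c⁻¹ * d, ?_⟩
    have : star e * e * x * (star e * e) = d • (star e * e) := by
      rw [← mul_smul_comm, ← hd]; simp only [mul_assoc]
    rw [smul_mul_assoc, smul_mul_assoc, mul_smul_comm, this]
    simp only [smul_smul]
    congr 1; ring
  · obtain ⟨b, hb⟩ := hJI (J.smul_mem c⁻¹ (hJ (star e) e he))
    rw [LinearMap.mulRight_apply] at hb
    apply hq0
    rw [← hq]
    nth_rewrite 1 [← hb]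
    rw [mul_assoc, h, mul_zero]

namespace IsMinimalProjection

variable {q : A} (hq : IsMinimalProjection q)
include hq

/-- The functional `τ` with `q x q = τ(x) q`. -/
noncomputable def coeff : A →ₗ[ℂ] ℂ where
  toFun x := (hq.exists_smul x).choose
  map_add' x y := smul_left_injective ℂ hq.ne_zero (by
    change (hq.exists_smul _).choose • q = ((hq.exists_smul x).choose + _) • q
    rw [add_smul, ← (hq.exists_smul _).choose_spec, ← (hq.exists_smul x).choose_spec,
      ← (hq.exists_smul y).choose_spec, mul_add, add_mul])
  map_smul' c x := smul_left_injective ℂ hq.ne_zero (by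
    change (hq.exists_smul _).choose • q = (c * (hq.exists_smul x).choose) • q
    rw [mul_smul, ← (hq.exists_smul _).choose_spec, ← (hq.exists_smul x).choose_spec,
      mul_smul_comm, smul_mul_assoc])

theorem coeff_smul (x : A) : hq.coeff x • q = q * x * q := (hq.exists_smul x).choose_spec.symm

theorem coeff_eq_of_smul {x : A} {c : ℂ} (h : q * x * q = c • q) : hq.coeff x = c :=
  smul_left_injective ℂ hq.ne_zero ((hq.coeff_smul x).trans h)

theorem coeff_star (x : A) : hq.coeff (star x) = star (hq.coeff x) := by
  apply hq.coeff_eq_of_smul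
  have := congrArg star (hq.coeff_smul x)
  simpa [hq.star_eq, mul_assoc] using this.symm

/-- If `x` and `y` lie in the left ideal `A q`, then `x* y` is a multiple of `q`. -/
theorem star_mul_eq {x y : A} (hx : x * q = x) (hy : y * q = y) :
    star x * y = hq.coeff (star x * y) • q := by
  have : q * star x = star x := by simpa [hq.star_eq] using congrArg star hx
  rw [coeff_smul, ← mul_assoc, this, mul_assoc, hy]

theorem star_mul_mul_eq {x y : A} (hx : x * q = x) (hy : y * q = y) (a : A) :
    star x * a * y = hq.coeff (star x * a * y) • q := by
  have h := hq.star_mul_eq hx (y := a * y) (by rw [mul_assoc, hy])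
  simpa only [mul_assoc] using h

/-- The left ideal `A q` is a Hilbert space for the inner product `x* y = ⟨x, y⟩ q`; it has an
orthonormal basis, characterised by `∑ eₖ eₖ* x = x`. -/
theorem exists_frame (ψ : A →ₗ[ℂ] ℂ) (hψ : ∀ a, 0 ≤ ψ (star a * a))
    (hψ0 : ∀ a, ψ (star a * a) = 0 → a = 0)
    (hfin : FiniteDimensional ℂ (LinearMap.range (LinearMap.mulRight ℂ q))) :
    ∃ n : ℕ, 0 < n ∧ ∃ e : Fin n → A, (∀ k, e k * q = e k) ∧
      (∀ k l, star (e k) * e l = if k = l then q else 0) ∧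
      ∀ x, x * q = x → ∑ k, e k * (star (e k) * x) = x := by
  classical
  let P : ℕ → Prop := fun n => ∃ e : Fin n → A, (∀ k, e k * q = e k) ∧
    (∀ k l, star (e k) * e l = if k = l then q else 0)
  -- orthonormal families are linearly independent, so there is one of maximal length
  have hbound : ∀ n, P n → n ≤ Module.finrank ℂ (LinearMap.range (LinearMap.mulRight ℂ q)) := by
    rintro n ⟨e, he, horth⟩
    have hli : LinearIndependent ℂ
        (fun k => (⟨e k, e k, he k⟩ : LinearMap.range (LinearMap.mulRight ℂ q))) := by
      refine Fintype.linearIndependent_iff.2 fun g hg k => ?_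
      have h := congrArg (fun z : LinearMap.range (LinearMap.mulRight ℂ q) =>
        star (e k) * (z : A)) hg
      simp [Finset.mul_sum, mul_smul_comm, horth] at h
      exact h.resolve_right hq.ne_zero
    simpa using hli.fintype_card_le_finrank
  have hP0 : P 0 := ⟨fun k => k.elim0, fun k => k.elim0, fun k => k.elim0⟩
  obtain ⟨n, ⟨e, he, horth⟩, hmax⟩ : ∃ n, P n ∧ ¬ P (n + 1) := by
    by_contra! h
    have hall : ∀ n, P n := fun n => Nat.rec hP0 (fun n hn => h n hn) n
    exact absurd (hbound _ (hall _)) (Nat.not_succ_le_self _)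
  have hsum : ∀ x, x * q = x → ∑ k, e k * (star (e k) * x) = x := by
    intro x hx
    by_contra hne
    -- otherwise the normalised remainder extends the family
    set r := x - ∑ k, e k * (star (e k) * x) with hr
    have hr0 : r ≠ 0 := fun h => hne (sub_eq_zero.1 h).symm
    have hrq : r * q = r := by
      simp only [hr, sub_mul, Finset.sum_mul, mul_assoc, hx]
    have her : ∀ k, star (e k) * r = 0 := by
      intro k
      have hqk : q * star (e k) = star (e k) := by
        simpa [hq.star_eq] using congrArg star (he k)
      simp only [hr, mul_sub, Finset.mul_sum, ← mul_assoc, horth]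
      simp [ite_mul, hqk]
    have hre : ∀ k, star r * e k = 0 := fun k => by
      simpa using congrArg star (her k)
    set c := hq.coeff (star r * r) with hcdef
    have hc : star r * r = c • q := hq.star_mul_eq hrq hrq
    have hψq : 0 < ψ q := by
      have h1 := hψ q
      have h2 := hψ0 q
      rw [hq.star_eq, hq.mul_self] at h1 h2
      exact lt_of_le_of_ne h1 fun h => hq.ne_zero (h2 h.symm)
    have hψr : 0 < c * ψ q := by
      rw [← smul_eq_mul, ← map_smul, ← hc]
      exact lt_of_le_of_ne (hψ r) fun h => hr0 (hψ0 r h.symm)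
    have hcpos : 0 < c := (pos_iff_pos_of_mul_pos hψr).2 hψq
    obtain ⟨t, ht, htc⟩ : ∃ t : ℝ, 0 < t ∧ (t : ℂ) = c :=
      ⟨c.re, (Complex.pos_iff.1 hcpos).1, by
        apply Complex.ext <;> simp [(Complex.pos_iff.1 hcpos).2]⟩
    set d : ℂ := (((Real.sqrt t)⁻¹ : ℝ) : ℂ) with hd
    have hdd : star d * d * c = 1 := by
      rw [← htc, hd, Complex.star_def, Complex.conj_ofReal, ← Complex.ofReal_mul,
        ← Complex.ofReal_mul, ← mul_inv, Real.mul_self_sqrt ht.le, inv_mul_cancel₀ ht.ne',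
        Complex.ofReal_one]
    refine hmax ⟨Fin.cons (d • r) e, fun k => ?_, fun k l => ?_⟩
    · refine Fin.cases ?_ (fun k => ?_) k
      · simp [smul_mul_assoc, hrq]
      · simp [he]
    · refine Fin.cases ?_ (fun k => ?_) k <;> refine Fin.cases ?_ (fun l => ?_) l
      · simp only [Fin.cons_zero, star_smul, smul_mul_smul_comm, hc, smul_smul, hdd, if_true,
          one_smul]
      · simp [smul_mul_assoc, hre, (Fin.succ_ne_zero _).symm]
      · simp [mul_smul_comm, her, Fin.succ_ne_zero]
      · simp [horth]
  refine ⟨n, Nat.pos_of_ne_zero ?_, e, he, horth, hsum⟩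
  rintro rfl
  exact hq.ne_zero (by simpa using (hsum q hq.mul_self).symm)

end IsMinimalProjection

variable (A) in
/-- A set of representatives of the minimal projections under the relation `p A q ≠ 0`, obtained
as a maximal set of mutually inequivalent ones. -/
theorem exists_maximal_inequivalent : ∃ Q : Set A, (∀ q ∈ Q, IsMinimalProjection q) ∧
    Q.Pairwise (fun p q => ∀ x, p * x * q = 0) ∧
    ∀ p, IsMinimalProjection p → ∃ q ∈ Q, ∃ x, p * x * q ≠ 0 := by
  obtain ⟨Q, hQ⟩ := zorn_subset
    {Q : Set A | (∀ q ∈ Q, IsMinimalProjection q) ∧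
      Q.Pairwise (fun p q => ∀ x, p * x * q = 0)} (by
    intro c hc hchain
    refine ⟨⋃₀ c, ⟨?_, ?_⟩, fun s hs => Set.subset_sUnion_of_mem hs⟩
    · rintro q ⟨s, hs, hq⟩
      exact (hc hs).1 q hq
    · exact (Set.pairwise_sUnion hchain.directedOn).2 fun s hs => (hc hs).2)
  refine ⟨Q, hQ.prop.1, hQ.prop.2, fun p hp => ?_⟩
  by_contra! h
  have hpQ : p ∈ Q := by
    refine hQ.le_of_ge (y := insert p Q) ⟨?_, ?_⟩ (Set.subset_insert p Q) (Set.mem_insert p Q)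
    · rintro q (rfl | hq)
      exacts [hp, hQ.prop.1 q hq]
    · refine hQ.prop.2.insert fun q hq _ => ⟨h q hq, fun x => ?_⟩
      simpa [hp.star_eq, (hQ.prop.1 q hq).star_eq, mul_assoc] using
        congrArg star (h q hq (star x))
  exact hp.ne_zero (by simpa [hp.mul_self] using h p hpQ p)

/-- If `p` and `q` are equivalent minimal projections, then an element annihilating `A q` from the
left annihilates `A p`. -/
theorem IsMinimalProjection.mul_eq_zero_of_equiv (hproper : ∀ a : A, star a * a = 0 → a = 0)
    {p q x a : A} (hp : IsMinimalProjection p) (hx : p * x * q ≠ 0)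
    (ha : ∀ y, a * y * q = 0) : a * p = 0 := by
  -- `u u*` is a nonzero multiple of `p` for `u = p x q`
  have hu : (p * x * q) * star (p * x * q) ≠ 0 := fun h => hx (by
    have := hproper (star (p * x * q)) (by rwa [star_star])
    simpa using congrArg star this)
  obtain ⟨c, hc⟩ := hp.exists_smul (x * q * star q * star x)
  have hcp : (p * x * q) * star (p * x * q) = c • p := by
    rw [← hc]; simp only [star_mul, hp.star_eq, mul_assoc]
  have hc0 : c ≠ 0 := by
    rintro rfl
    exact hu (by rw [hcp, zero_smul])
  have : c • (a * p) = 0 := by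
    have h := ha (p * x)
    rw [← mul_smul_comm, ← hcp, ← mul_assoc, ← mul_assoc a, h, zero_mul]
  exact (smul_eq_zero.1 this).resolve_left hc0

/-- A `*`-algebra with a positive definite functional whose principal left ideals are
finite-dimensional is an algebraic direct sum of full matrix algebras. -/
theorem isDirectSumOfMatrixAlgebras_of_posDef (ψ : A →ₗ[ℂ] ℂ) (hψ : ∀ a, 0 ≤ ψ (star a * a))
    (hψ0 : ∀ a, ψ (star a * a) = 0 → a = 0)
    (hfin : ∀ a : A, FiniteDimensional ℂ (LinearMap.range (LinearMap.mulRight ℂ a))) :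
    IsDirectSumOfMatrixAlgebras A := by
  classical
  have hproper : ∀ a : A, star a * a = 0 → a = 0 := fun a h => hψ0 a (by rw [h, map_zero])
  obtain ⟨Q, hQ, hQQ, hQmax⟩ := exists_maximal_inequivalent A
  choose n hn e he horth hsum using fun i : Q => (hQ i i.2).exists_frame ψ hψ hψ0 (hfin i)
  have hqe : ∀ (i : Q) k, (i : A) * star (e i k) = star (e i k) := fun i k => by
    simpa [(hQ i i.2).star_eq] using congrArg star (he i k)
  -- the left ideals `A qᵢ` are mutually orthogonal, and remain so under the action of `A`
  have hcross : ∀ i j : Q, i ≠ j → ∀ k l, star (e i k) * e j l = 0 := by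
    intro i j hij k l
    rw [← hqe i k, ← he j l]
    have := hQQ i.2 j.2 (fun h => hij (Subtype.ext h)) (star (e i k) * e j l)
    simpa only [mul_assoc] using this
  have hmid : ∀ i j : Q, i ≠ j → ∀ k l a, star (e i k) * a * e j l = 0 := by
    intro i j hij k l a
    rw [← hqe i k, ← he j l]
    have := hQQ i.2 j.2 (fun h => hij (Subtype.ext h)) (star (e i k) * a * e j l)
    simpa only [mul_assoc] using this
  -- the matrix of the left multiplication by `a` on `A qᵢ`
  let π : A → ∀ i : Q, Matrix (Fin (n i)) (Fin (n i)) ℂ := fun a i =>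
    Matrix.of fun k l => (hQ i i.2).coeff (star (e i k) * a * e i l)
  have hπ : ∀ a i k l, star (e i k) * a * e i l = π a i k l • (i : A) := fun a i k l =>
    (hQ i i.2).star_mul_mul_eq (he i k) (he i l) a
  have hπ_eq : ∀ a i k l c, star (e i k) * a * e i l = c • (i : A) → π a i k l = c := by
    intro a i k l c h
    rw [hπ] at h
    exact smul_left_injective ℂ (hQ i i.2).ne_zero h
  -- the left multiplication by `a`, expanded in the frame
  have hexp : ∀ a i l, a * e i l = ∑ k, π a i k l • e i k := by
    intro a i l
    rw [← hsum i (a * e i l) (by rw [mul_assoc, he])]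
    refine Finset.sum_congr rfl fun k _ => ?_
    rw [← mul_assoc (star _), hπ, mul_smul_comm, he]
  have hπ_of : ∀ a i l (f : Fin (n i) → ℂ), a * e i l = ∑ k, f k • e i k →
      ∀ k, π a i k l = f k := by
    intro a i l f h k
    apply hπ_eq
    rw [mul_assoc, h, Finset.mul_sum]
    simp [mul_smul_comm, horth]
  have hπ_add : ∀ a b, π (a + b) = π a + π b := fun a b => by
    ext i k l; simp [π, mul_add, add_mul]
  have hπ_smul : ∀ (c : ℂ) a, π (c • a) = c • π a := fun c a => by
    ext i k l; simp [π, mul_smul_comm, smul_mul_assoc]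
  have hπ_mul : ∀ a b, π (a * b) = π a * π b := by
    intro a b
    ext i k l
    refine hπ_of _ _ _ (fun k => (π a * π b) i k l) ?_ k
    rw [mul_assoc, hexp, Finset.mul_sum]
    simp only [mul_smul_comm, hexp, Finset.smul_sum, Pi.mul_apply, Matrix.mul_apply,
      Finset.sum_smul, smul_smul]
    rw [Finset.sum_comm]
    simp only [mul_comm]
  have hπ_star : ∀ a, π (star a) = star (π a) := by
    intro a
    ext i k l
    simp only [π, Pi.star_apply, Matrix.star_apply, Matrix.of_apply]
    rw [← (hQ i i.2).coeff_star]
    simp [mul_assoc]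
  have hπ_inj : ∀ a, π a = 0 → a = 0 := by
    intro a h
    by_contra ha
    obtain ⟨p, hp, hap⟩ := exists_isMinimalProjection hproper hfin ha
    obtain ⟨q, hq, x, hx⟩ := hQmax p hp
    refine hap (hp.mul_eq_zero_of_equiv hproper hx fun y => ?_)
    rw [mul_assoc, ← hsum ⟨q, hq⟩ (y * q) (by rw [mul_assoc, (hQ q hq).mul_self]),
      Finset.mul_sum]
    refine Finset.sum_eq_zero fun k _ => ?_
    rw [← mul_assoc, hexp, h]
    simp
  -- nonzero components give mutually orthogonal nonzero vectors in a finite-dimensional space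
  have hπ_fin : ∀ a, {i | π a i ≠ 0}.Finite := by
    intro a
    have hex : ∀ i : {i // π a i ≠ 0}, ∃ l, a * e i l ≠ 0 := by
      rintro ⟨i, hi⟩
      by_contra! h
      refine hi (Matrix.ext fun k l => hπ_eq _ _ _ _ _ ?_)
      rw [mul_assoc, h]
      simp
    choose l hl using hex
    have hli : LinearIndependent ℂ (fun i : {i // π a i ≠ 0} =>
        (⟨star (e i (l i)) * star a, star (e i (l i)), rfl⟩ :
          LinearMap.range (LinearMap.mulRight ℂ (star a)))) := by
      refine linearIndependent_iff'.2 fun s g hg j hj => ?_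
      have h := congrArg (fun z : LinearMap.range (LinearMap.mulRight ℂ (star a)) =>
        (z : A) * (a * e j (l j))) hg
      simp only [AddSubmonoidClass.coe_finsetSum, Submodule.coe_smul, Finset.sum_mul,
        smul_mul_assoc, Submodule.coe_zero, zero_mul] at h
      rw [Finset.sum_eq_single_of_mem j hj] at h
      · refine (smul_eq_zero.1 h).resolve_right fun h0 => hl j (hproper _ ?_)
        simpa [mul_assoc] using h0
      · intro i _ hij
        have := hmid i j (fun h => hij (Subtype.ext h)) (l i) (l j) (star a * a)
        rw [mul_assoc] at this
        rw [mul_assoc, ← mul_assoc (star a), this, smul_zero]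
    have := hfin (star a)
    exact hli.finite
  -- `eₖ eₗ*` acts on `A qᵢ` as a matrix unit and by zero on the other spaces
  have hπ_surj : ∀ M : ∀ i : Q, Matrix (Fin (n i)) (Fin (n i)) ℂ, {i | M i ≠ 0}.Finite →
      ∃ a, π a = M := by
    intro M hM
    refine ⟨∑ i ∈ hM.toFinset, ∑ k, ∑ l, M i k l • (e i k * star (e i l)), ?_⟩
    ext j k₀ l₀
    refine hπ_of _ _ _ (fun k => M j k l₀) ?_ k₀
    rw [Finset.sum_mul, Finset.sum_eq_single j]
    · simp only [Finset.sum_mul, smul_mul_assoc, mul_assoc, horth]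
      simp [mul_ite, he]
    · intro i _ hij
      simp only [Finset.sum_mul, smul_mul_assoc]
      refine Finset.sum_eq_zero fun k _ => Finset.sum_eq_zero fun l _ => ?_
      rw [mul_assoc, hcross i j hij, mul_zero, smul_zero]
    · intro hj
      have : M j = 0 := by simpa using hj
      simp [this]
  let F : A →⋆ₙₐ[ℂ] matrixDirectSum n :=
    { toFun a := ⟨π a, hπ_fin a⟩
      map_smul' c a := Subtype.ext (hπ_smul c a)
      map_zero' := Subtype.ext (by simpa using hπ_smul 0 0)
      map_add' a b := Subtype.ext (hπ_add a b)
      map_mul' a b := Subtype.ext (hπ_mul a b)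
      map_star' a := Subtype.ext (hπ_star a) }
  refine ⟨Q, n, hn, ⟨StarAlgEquiv.ofBijective F ⟨?_, ?_⟩⟩⟩
  · refine (injective_iff_map_eq_zero F).2 fun a ha => hπ_inj a (congrArg Subtype.val ha)
  · rintro ⟨M, hM⟩
    obtain ⟨a, ha⟩ := hπ_surj M hM
    exact ⟨a, Subtype.ext ha⟩

end MatrixDecomposition
open Coalgebra HopfAlgebra WithConv

namespace PositiveIntegral

/-! ### Faithfulness of the integral and the integral on the dual -/

variable {B : Type u} [Ring B] [HopfAlgebra ℂ B] [StarRing B] [StarModule ℂ B]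
  [IsHopfStarAlgebra B] (φ : PositiveIntegral B)

/-- A Sweedler sum whose left legs are distinct members of a given basis. -/
theorem exists_repr_basis (c : B) {ι : Type*} (e : Module.Basis ι ℂ B) :
    ∃ r : Coalgebra.Repr ℂ c ι, r.left = e := by
  classical
  let f := TensorProduct.equivFinsuppOfBasisLeft (N := B) e (comul c)
  refine ⟨⟨f.support, e, f, ?_⟩, rfl⟩
  have : comul c = f.sum fun i m => e i ⊗ₜ[ℂ] m := by
    rw [← TensorProduct.equivFinsuppOfBasisLeft_symm_apply e f]
    exact (LinearEquiv.symm_apply_apply _ _).symm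
  rw [this, Finsupp.sum]

/-- The kernel of `c ↦ φ(· c)` is a left coideal, so `φ(1) ε(c) = φ(S(c₁) c₂)` vanishes on it;
applying this to the slices of `Δ(c)` gives `c = 0`. -/
theorem functional_injective {c : B} (h : φ.functional c = 0) : c = 0 := by
  have hcounit : ∀ c : B, φ.functional c = 0 → counit (R := ℂ) c = 0 := by
    intro c hc
    obtain ⟨e⟩ : Nonempty (Module.Basis (Module.Basis.ofVectorSpaceIndex ℂ B) ℂ B) :=
      ⟨Module.Basis.ofVectorSpace ℂ B⟩
    obtain ⟨r, hr⟩ := exists_repr_basis c e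
    -- slicing with the coordinate functionals shows that the right legs lie in the kernel
    have hright : ∀ j ∈ r.index, φ.functional (r.right j) = 0 := by
      intro j hj
      have h1 := φ.mul_functional
        (toConv (e.coord j ∘ₗ antipode ℂ)) r
      rw [hc, mul_zero, hr] at h1
      classical
      simpa [antipode_antipodeInv, Finsupp.single_apply, hj] using h1.symm
    have h2 := congrArg φ.toLinearMap (HopfAlgebra.sum_antipode_mul_eq_algebraMap_counit r)
    rw [map_sum, Finset.sum_eq_zero, Algebra.algebraMap_eq_smul_one, map_smul, smul_eq_mul] at h2
    · exact (mul_eq_zero.1 h2.symm).resolve_right φ.apply_one_ne_zero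
    · intro j hj
      exact congrArg (fun ω => ω.ofConv (antipode ℂ (r.left j))) (hright j hj)
  -- every slice `ω(S⁻¹(c₁)) c₂` lies in the kernel, and its counit is `ω(S⁻¹(c))`
  have hinv : antipodeInv c = 0 := by
    refine (Module.forall_dual_apply_eq_zero_iff ℂ _).1 fun ω => ?_
    let r := Coalgebra.Repr.arbitrary ℂ c
    have h1 := φ.mul_functional (toConv ω) r
    rw [h, mul_zero] at h1
    have h2 := hcounit _ h1.symm
    rw [← sum_smul_counit r]
    simpa [mul_comm] using h2
  rw [← antipode_antipodeInv c, hinv, map_zero]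

/-- By the Cauchy-Schwarz inequality, a null vector of `φ` is orthogonal to everything. -/
theorem apply_mul_eq_zero {b : B} (h : φ (star b * b) = 0) (x : B) : φ (x * b) = 0 := by
  let core : PreInnerProductSpace.Core ℂ B :=
    { inner x y := φ (star x * y)
      conj_inner_symm x y := by
        change star (φ (star y * x)) = _
        rw [← φ.apply_star, star_mul, star_star]
      re_inner_nonneg x := φ.re_nonneg x
      add_left x y z := by simp [add_mul]
      smul_left x y c := by simp }
  have key := @InnerProductSpace.Core.inner_mul_inner_self_le ℂ B _ _ _ core (star x) b
  change ‖φ (star (star x) * b)‖ * ‖φ (star b * star x)‖ ≤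
    (φ (star (star x) * star x)).re * (φ (star b * b)).re at key
  have hx : φ (star b * star x) = star (φ (x * b)) := by rw [← φ.apply_star, star_mul]
  rw [h, hx, star_star, norm_star, Complex.zero_re, mul_zero] at key
  exact norm_eq_zero.1 (mul_self_eq_zero.1 (le_antisymm key (mul_self_nonneg _)))

theorem eq_zero_of_apply_star_mul_self {b : B} (h : φ (star b * b) = 0) : b = 0 :=
  φ.functional_injective (by ext x; exact φ.apply_mul_eq_zero h x)

theorem pairing_ext {a b : φ.DualAlgebra} (h : ∀ x, φ.pairing a x = φ.pairing b x) : a = b :=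
  φ.incl_injective (by ext x; exact h x)

/-- The linear bijection `b ↦ φ(· b)` from `B` to its dual. -/
noncomputable def elemEquiv : B ≃ₗ[ℂ] φ.DualAlgebra :=
  LinearEquiv.ofBijective
    { toFun := φ.elem
      map_add' b c := φ.pairing_ext fun x => by
        change φ (x * (b + c)) = φ (x * b) + φ (x * c)
        rw [mul_add, map_add]
      map_smul' k b := φ.pairing_ext fun x => by
        change φ (x * (k • b)) = k * φ (x * b)
        rw [mul_smul_comm, map_smul, smul_eq_mul] }
    ⟨(injective_iff_map_eq_zero _).2 fun b hb => φ.functional_injective (congrArg φ.incl hb), by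
      rintro ⟨_, b, rfl⟩
      exact ⟨b, rfl⟩⟩

theorem elemEquiv_apply (b : B) : φ.elemEquiv b = φ.elem b := rfl

theorem elemEquiv_symm_elem (b : B) : φ.elemEquiv.symm (φ.elem b) = b :=
  φ.elemEquiv.symm_apply_apply b

theorem exists_eq_elem (a : φ.DualAlgebra) : ∃ b, a = φ.elem b :=
  (φ.elemEquiv.surjective a).imp fun _ h => h.symm

/-- Multiplication by a functional `φ(· c)` from the right, by strong left invariance. -/
theorem mul_elem (a : φ.DualAlgebra) {ι : Type*} {c : B} (r : Coalgebra.Repr ℂ c ι) :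
    a * φ.elem c = ∑ i ∈ r.index, φ.pairing a (antipodeInv (r.left i)) • φ.elem (r.right i) := by
  have : a * φ.elem c =
      φ.elemEquiv (∑ i ∈ r.index, φ.pairing a (antipodeInv (r.left i)) • r.right i) :=
    φ.incl_injective (φ.mul_functional (φ.incl a) r)
  simpa only [map_sum, map_smul, elemEquiv_apply] using this

/-- Multiplication by a functional `φ(· c)` from the left, by strong right invariance. -/
theorem elem_mul (a : φ.DualAlgebra) {ι : Type*} {c : B} (r : Coalgebra.Repr ℂ c ι) :
    φ.elem c * a = ∑ i ∈ r.index, φ.pairing a (antipode ℂ (r.right i)) • φ.elem (r.left i) := by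
  refine φ.pairing_ext fun x => ?_
  have h := φ.strong_right' (φ.incl a).ofConv x r
  let q := Coalgebra.Repr.arbitrary ℂ x
  have h1 : φ.pairing (φ.elem c * a) x = _ := q.convMul_apply _ _
  rw [h1]
  rw [← q.eq] at h
  simp only [Finset.sum_mul, map_sum, Algebra.TensorProduct.tmul_mul_tmul, mul_one,
    TensorProduct.map_tmul, LinearMap.mul'_apply] at h
  refine h.trans ?_
  simp only [pairing, map_sum, map_smul, WithConv.ofConv_sum, WithConv.ofConv_smul,
    LinearMap.sum_apply, LinearMap.smul_apply, smul_eq_mul]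
  exact Finset.sum_congr rfl fun i _ => mul_comm _ _

/-- The integral `φ(· b) ↦ ε(b)` on the dual. -/
noncomputable def dualIntegral : φ.DualAlgebra →ₗ[ℂ] ℂ :=
  counit (R := ℂ) (A := B) ∘ₗ φ.elemEquiv.symm.toLinearMap

theorem dualIntegral_elem (b : B) : φ.dualIntegral (φ.elem b) = counit (R := ℂ) b :=
  congrArg _ (φ.elemEquiv_symm_elem b)

/-- The Plancherel formula: `φ_A(a* a) = φ(b* b)` for `a = φ(· b)`. -/
theorem dualIntegral_star_mul_self (b : B) :
    φ.dualIntegral (star (φ.elem b) * φ.elem b) = φ (star b * b) := by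
  let r := Coalgebra.Repr.arbitrary ℂ b
  have h : φ.dualIntegral (star (φ.elem b) * φ.elem b) =
      φ.pairing (star (φ.elem b)) (antipodeInv b) := by
    rw [φ.mul_elem _ r]
    have h1 := congrArg antipodeInv (sum_smul_counit r)
    simp only [map_sum, map_smul] at h1
    rw [← h1]
    simp only [map_sum, map_smul, dualIntegral_elem, smul_eq_mul, pairing]
    exact Finset.sum_congr rfl fun i _ => mul_comm (_ : ℂ) _
  rw [h]
  change star (φ (star (antipode ℂ (antipodeInv b)) * b)) = _
  rw [antipode_antipodeInv, ← φ.apply_star, star_mul, star_star]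

theorem dualIntegral_nonneg (a : φ.DualAlgebra) : 0 ≤ φ.dualIntegral (star a * a) := by
  obtain ⟨b, rfl⟩ := φ.exists_eq_elem a
  rw [dualIntegral_star_mul_self]
  exact φ.positive b

theorem dualIntegral_definite (a : φ.DualAlgebra) (h : φ.dualIntegral (star a * a) = 0) :
    a = 0 := by
  obtain ⟨b, rfl⟩ := φ.exists_eq_elem a
  rw [dualIntegral_star_mul_self] at h
  rw [φ.eq_zero_of_apply_star_mul_self h]
  exact map_zero φ.elemEquiv

/-- A principal left ideal of the dual is spanned by the functionals of the right legs of a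
coproduct. -/
theorem finiteDimensional_range_mulRight (a : φ.DualAlgebra) :
    FiniteDimensional ℂ (LinearMap.range (LinearMap.mulRight ℂ a)) := by
  obtain ⟨c, rfl⟩ := φ.exists_eq_elem a
  let r := Coalgebra.Repr.arbitrary ℂ c
  have : FiniteDimensional ℂ
      (Submodule.span ℂ ((fun i => φ.elem (r.right i)) '' (r.index : Set _))) :=
    FiniteDimensional.span_of_finite ℂ (r.index.finite_toSet.image _)
  refine Submodule.finiteDimensional_of_le
    (S₂ := Submodule.span ℂ ((fun i => φ.elem (r.right i)) '' (r.index : Set _))) ?_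
  rintro _ ⟨x, rfl⟩
  rw [LinearMap.mulRight_apply, φ.mul_elem x r]
  exact Submodule.sum_mem _ fun i hi =>
    Submodule.smul_mem _ _ (Submodule.subset_span ⟨i, hi, rfl⟩)

theorem isDirectSumOfMatrixAlgebras_dualAlgebra : IsDirectSumOfMatrixAlgebras φ.DualAlgebra :=
  isDirectSumOfMatrixAlgebras_of_posDef φ.dualIntegral φ.dualIntegral_nonneg
    φ.dualIntegral_definite φ.finiteDimensional_range_mulRight

theorem eq_zero_of_forall_mul_right_eq_zero (a : φ.DualAlgebra) (h : ∀ b, a * b = 0) : a = 0 :=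
  star_eq_zero.1 (φ.dualIntegral_definite (star a) (by rw [star_star, h, map_zero]))

theorem eq_zero_of_forall_mul_left_eq_zero (a : φ.DualAlgebra) (h : ∀ b, b * a = 0) : a = 0 :=
  φ.dualIntegral_definite a (by rw [h, map_zero])

theorem mul_elem_one (a : φ.DualAlgebra) : a * φ.elem 1 = φ.dualCounit a • φ.elem 1 := by
  let r : Coalgebra.Repr ℂ (1 : B) Unit := ⟨{()}, fun _ => 1, fun _ => 1, by
    simp [Algebra.TensorProduct.one_def]⟩
  rw [φ.mul_elem a r]
  simp [r, antipodeInv_one, dualCounit_apply]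

theorem elem_one_mul (a : φ.DualAlgebra) : φ.elem 1 * a = φ.dualCounit a • φ.elem 1 := by
  let r : Coalgebra.Repr ℂ (1 : B) Unit := ⟨{()}, fun _ => 1, fun _ => 1, by
    simp [Algebra.TensorProduct.one_def]⟩
  rw [φ.elem_mul a r]
  simp [r, dualCounit_apply]

theorem star_elem_one : star (φ.elem 1) = φ.elem 1 :=
  φ.incl_injective (by
    rw [incl_star]
    refine (φ.dualStar_functional 1).trans ?_
    rw [star_one, antipodeInv_one]
    rfl)

theorem elem_one_ne_zero : φ.elem 1 ≠ 0 := fun h => φ.apply_one_ne_zero (by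
  have h1 : φ.pairing (φ.elem 1) 1 = 0 := by rw [h]; rfl
  rwa [pairing_elem, mul_one] at h1)

end PositiveIntegral

/-! ### Twisting one leg of a tensor product by a coproduct -/

section CoactionMaps

variable {B : Type u} [Ring B] [HopfAlgebra ℂ B] {V : Type*} [AddCommGroup V] [Module ℂ V]

/-- The map `c ⊗ v ↦ c₁ ⊗ f(c₂) v` of `B ⊗ V`. -/
noncomputable def twistRight (f : B →ₗ[ℂ] Module.End ℂ V) : B ⊗[ℂ] V →ₗ[ℂ] B ⊗[ℂ] V :=
  (TensorProduct.lift f).lTensor B ∘ₗ (TensorProduct.assoc ℂ B B V).toLinearMap ∘ₗ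
    (comul (R := ℂ) (A := B)).rTensor V

theorem twistRight_tmul (f : B →ₗ[ℂ] Module.End ℂ V) {ι : Type*} {c : B}
    (r : Coalgebra.Repr ℂ c ι) (v : V) :
    twistRight f (c ⊗ₜ v) = ∑ i ∈ r.index, r.left i ⊗ₜ[ℂ] f (r.right i) v := by
  simp [twistRight, ← r.eq, TensorProduct.sum_tmul]

/-- The map `v ⊗ e ↦ f(e₁) v ⊗ e₂` of `V ⊗ B`. -/
noncomputable def twistLeft (f : B →ₗ[ℂ] Module.End ℂ V) : V ⊗[ℂ] B →ₗ[ℂ] V ⊗[ℂ] B :=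
  (TensorProduct.lift f.flip).rTensor B ∘ₗ (TensorProduct.assoc ℂ V B B).symm.toLinearMap ∘ₗ
    (comul (R := ℂ) (A := B)).lTensor V

theorem twistLeft_tmul (f : B →ₗ[ℂ] Module.End ℂ V) {ι : Type*} {e : B}
    (r : Coalgebra.Repr ℂ e ι) (v : V) :
    twistLeft f (v ⊗ₜ e) = ∑ i ∈ r.index, f (r.left i) v ⊗ₜ[ℂ] r.right i := by
  simp [twistLeft, ← r.eq, TensorProduct.tmul_sum]

/-- If `f(c₁) g(c₂) = ε(c)`, then `twistRight f` is a left inverse of `twistRight g`. -/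
theorem twistRight_comp_twistRight (f g : B →ₗ[ℂ] Module.End ℂ V)
    (h : ∀ x : B, LinearMap.mul' ℂ (Module.End ℂ V) (TensorProduct.map f g (comul x)) =
      counit (R := ℂ) x • 1) : twistRight f ∘ₗ twistRight g = LinearMap.id := by
  refine TensorProduct.ext' fun c v => ?_
  let r := Coalgebra.Repr.arbitrary ℂ c
  have h1 := sum_coassoc ((LinearMap.applyₗ v ∘ₗ LinearMap.mul' ℂ (Module.End ℂ V) ∘ₗ
    TensorProduct.map f g).lTensor B) r
  simp only [LinearMap.lTensor_tmul, LinearMap.comp_apply, h, map_smul,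
    LinearMap.applyₗ_apply_apply, Module.End.one_apply, ← TensorProduct.smul_tmul] at h1
  rw [← TensorProduct.sum_tmul, sum_smul_counit] at h1
  rw [LinearMap.comp_apply, twistRight_tmul g r, map_sum, LinearMap.id_apply, h1]
  refine Finset.sum_congr rfl fun i _ => ?_
  let q := Coalgebra.Repr.arbitrary ℂ (r.left i)
  rw [twistRight_tmul f q, ← q.eq]
  simp [TensorProduct.sum_tmul]

/-- If `f(e₂) g(e₁) = ε(e)`, then `twistLeft f` is a left inverse of `twistLeft g`. -/
theorem twistLeft_comp_twistLeft (f g : B →ₗ[ℂ] Module.End ℂ V)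
    (h : ∀ x : B, LinearMap.mul' ℂ (Module.End ℂ V)
      (TensorProduct.map f g (TensorProduct.comm ℂ B B (comul x))) = counit (R := ℂ) x • 1) :
    twistLeft f ∘ₗ twistLeft g = LinearMap.id := by
  refine TensorProduct.ext' fun v e => ?_
  let r := Coalgebra.Repr.arbitrary ℂ e
  have h1 := sum_coassoc ((LinearMap.applyₗ v ∘ₗ LinearMap.mul' ℂ (Module.End ℂ V) ∘ₗ
    TensorProduct.map f g ∘ₗ (TensorProduct.comm ℂ B B).toLinearMap).rTensor B ∘ₗ
    (TensorProduct.assoc ℂ B B B).symm.toLinearMap) r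
  simp only [LinearMap.rTensor_tmul, LinearMap.comp_apply, LinearEquiv.coe_coe,
    LinearEquiv.symm_apply_apply, h, map_smul,
    LinearMap.applyₗ_apply_apply, Module.End.one_apply, TensorProduct.smul_tmul] at h1
  rw [← TensorProduct.tmul_sum, Coalgebra.sum_counit_smul] at h1
  rw [LinearMap.comp_apply, twistLeft_tmul g r, map_sum, LinearMap.id_apply, ← h1]
  refine Finset.sum_congr rfl fun i _ => ?_
  let q := Coalgebra.Repr.arbitrary ℂ (r.right i)
  rw [twistLeft_tmul f q, ← q.eq]
  simp [TensorProduct.tmul_sum]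

/-- The tensor product `x ⊗ y ↦ ω(x) χ(y)` of two functionals. -/
noncomputable def tensorFunctional (ω χ : WithConv (B →ₗ[ℂ] ℂ)) :
    WithConv (B ⊗[ℂ] B →ₗ[ℂ] ℂ) :=
  toConv (LinearMap.mul' ℂ ℂ ∘ₗ TensorProduct.map ω.ofConv χ.ofConv)

theorem tensorFunctional_mul (ω χ ω' χ' : WithConv (B →ₗ[ℂ] ℂ)) :
    tensorFunctional ω χ * tensorFunctional ω' χ' = tensorFunctional (ω * ω') (χ * χ') := by
  ext x y
  let r := Coalgebra.Repr.arbitrary ℂ x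
  let q := Coalgebra.Repr.arbitrary ℂ y
  have h1 := r.convMul_apply ω ω'
  have h2 := q.convMul_apply χ χ'
  have h3 := (r.tmul q).convMul_apply (tensorFunctional ω χ) (tensorFunctional ω' χ')
  refine h3.trans ?_
  change _ = (ω * ω') x * (χ * χ') y
  rw [h1, h2, Finset.sum_mul_sum]
  simp only [Coalgebra.Repr.tmul, Finset.sum_product]
  refine Finset.sum_congr rfl fun i _ => Finset.sum_congr rfl fun j _ => ?_
  exact mul_mul_mul_comm _ _ _ _

end CoactionMaps

/-! ### Tensor squares of non-degenerate algebras -/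

section Nondegenerate

variable {A : Type u} [NonUnitalRing A] [Module ℂ A] [IsScalarTower ℂ A A] [SMulCommClass ℂ A A]

/-- If no nonzero element of `A` annihilates `A`, the same holds for `A ⊗ A`. -/
theorem tensor_eq_zero_of_mul_eq_zero (hA : ∀ a : A, (∀ b, a * b = 0) → a = 0)
    {t : A ⊗[ℂ] A} (ht : ∀ a b : A, t * (a ⊗ₜ b) = 0) : t = 0 := by
  classical
  let e := Module.Basis.ofVectorSpace ℂ A
  let c := TensorProduct.equivFinsuppOfBasisLeft (N := A) e t
  have hc : t = ∑ i ∈ c.support, e i ⊗ₜ c i := by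
    have := TensorProduct.equivFinsuppOfBasisLeft_symm_apply e c
    rw [Finsupp.sum] at this
    rw [← this]
    exact (LinearEquiv.symm_apply_apply _ t).symm
  rw [hc]
  refine Finset.sum_eq_zero fun i hi => ?_
  suffices h : c i = 0 by rw [h, TensorProduct.tmul_zero]
  refine hA _ fun b => (Module.forall_dual_apply_eq_zero_iff ℂ _).1 fun χ => ?_
  -- slicing with `χ(· b)` gives a linear combination of the `e i` which annihilates `A`
  have h0 : ∑ k ∈ c.support, χ (c k * b) • e k = 0 := by
    refine hA _ fun a => ?_
    have h := congrArg (fun s => TensorProduct.rid ℂ A (χ.lTensor A s)) (ht a b)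
    rw [hc] at h
    simpa [Finset.sum_mul, smul_mul_assoc] using h
  exact linearIndependent_iff'.1 e.linearIndependent c.support (fun k => χ (c k * b)) h0 i hi

theorem Multiplier.coe_tensor_injective (hA : ∀ a : A, (∀ b, a * b = 0) → a = 0) :
    Function.Injective (Multiplier.coe : A ⊗[ℂ] A → Multiplier (A ⊗[ℂ] A)) := by
  intro s t h
  refine sub_eq_zero.1 (tensor_eq_zero_of_mul_eq_zero hA fun a b => ?_)
  have h1 : s * (a ⊗ₜ b) = t * (a ⊗ₜ b) := congrArg (fun m => m.left (a ⊗ₜ b)) h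
  rw [sub_mul, h1, sub_self]

end Nondegenerate

/-! ### The canonical maps of the dual -/

namespace PositiveIntegral

variable {B : Type u} [Ring B] [HopfAlgebra ℂ B] [StarRing B] [StarModule ℂ B]
  [IsHopfStarAlgebra B] (φ : PositiveIntegral B)

theorem pairing_add_right (a : φ.DualAlgebra) (x y : B) :
    φ.pairing a (x + y) = φ.pairing a x + φ.pairing a y := map_add _ _ _

theorem pairing_smul_right (c : ℂ) (a : φ.DualAlgebra) (x : B) :
    φ.pairing a (c • x) = c * φ.pairing a x := map_smul _ _ _

/-- The left action `⟨p ▷ a, x⟩ = ⟨a, x p⟩` of `B` on its dual. -/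
noncomputable def leftAction : B →ₗ[ℂ] Module.End ℂ φ.DualAlgebra :=
  φ.elemEquiv.conj.toLinearMap ∘ₗ LinearMap.mul ℂ B

theorem leftAction_elem (p b : B) : φ.leftAction p (φ.elem b) = φ.elem (p * b) := by
  change φ.elemEquiv (p * φ.elemEquiv.symm (φ.elem b)) = _
  rw [elemEquiv_symm_elem, elemEquiv_apply]

theorem pairing_leftAction (p : B) (a : φ.DualAlgebra) (x : B) :
    φ.pairing (φ.leftAction p a) x = φ.pairing a (x * p) := by
  obtain ⟨b, rfl⟩ := φ.exists_eq_elem a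
  rw [leftAction_elem, pairing_elem, pairing_elem, mul_assoc]

/-- The right action `⟨a ◁ p, x⟩ = ⟨a, p x⟩` of `B` on its dual. -/
noncomputable def rightAction : B →ₗ[ℂ] Module.End ℂ φ.DualAlgebra :=
  LinearMap.mk₂ ℂ (fun p a => ⟨toConv ((φ.incl a).ofConv ∘ₗ LinearMap.mulLeft ℂ p),
      φ.mulLeft_mem_dualSubalgebra p (φ.incl_mem a)⟩)
    (fun p q a => φ.pairing_ext fun x => by
      change φ.pairing a ((p + q) * x) = φ.pairing a (p * x) + φ.pairing a (q * x)
      rw [add_mul, pairing_add_right])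
    (fun c p a => φ.pairing_ext fun x => by
      change φ.pairing a ((c • p) * x) = c * φ.pairing a (p * x)
      rw [smul_mul_assoc, pairing_smul_right])
    (fun _ _ _ => φ.pairing_ext fun _ => rfl)
    (fun _ _ _ => φ.pairing_ext fun _ => rfl)

theorem pairing_rightAction (p : B) (a : φ.DualAlgebra) (x : B) :
    φ.pairing (φ.rightAction p a) x = φ.pairing a (p * x) := rfl

theorem leftAction_mul (p q : B) :
    φ.leftAction (p * q) = φ.leftAction p * φ.leftAction q :=
  LinearMap.ext fun a => φ.pairing_ext fun x => by
    simp only [Module.End.mul_apply, pairing_leftAction, mul_assoc]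

theorem rightAction_mul (p q : B) :
    φ.rightAction (p * q) = φ.rightAction q * φ.rightAction p :=
  LinearMap.ext fun a => φ.pairing_ext fun x => by
    simp only [Module.End.mul_apply, pairing_rightAction, mul_assoc]

theorem leftAction_one : φ.leftAction 1 = 1 :=
  LinearMap.ext fun a => φ.pairing_ext fun x => by
    rw [pairing_leftAction, mul_one, Module.End.one_apply]

theorem rightAction_one : φ.rightAction 1 = 1 :=
  LinearMap.ext fun a => φ.pairing_ext fun x => by
    rw [pairing_rightAction, one_mul, Module.End.one_apply]

theorem leftAction_rightAction (p q : B) (a : φ.DualAlgebra) :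
    φ.leftAction p (φ.rightAction q a) = φ.rightAction q (φ.leftAction p a) :=
  φ.pairing_ext fun x => by
    simp only [pairing_leftAction, pairing_rightAction, mul_assoc]

/-- `v ⊗ e ↦ v ◁ S⁻¹(e₁) ⊗ e₂`, a bijection with inverse `v ⊗ e ↦ v ◁ S⁻²(e₁) ⊗ e₂`. -/
noncomputable def twistLeftEquiv : φ.DualAlgebra ⊗[ℂ] B ≃ₗ[ℂ] φ.DualAlgebra ⊗[ℂ] B :=
  LinearEquiv.ofLinearMap (twistLeft (φ.rightAction ∘ₗ antipodeInv))
    (twistLeft (φ.rightAction ∘ₗ antipodeInv ∘ₗ antipodeInv))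
    (twistLeft_comp_twistLeft _ _ fun x => by
      let r := Coalgebra.Repr.arbitrary ℂ x
      have h := congrArg (fun z => φ.rightAction (antipodeInv z))
        (sum_right_mul_antipodeInv_left r)
      rw [← r.eq]
      simpa [antipodeInv_mul, rightAction_mul, rightAction_one, antipodeInv_one,
        Algebra.algebraMap_eq_smul_one] using h)
    (twistLeft_comp_twistLeft _ _ fun x => by
      let r := Coalgebra.Repr.arbitrary ℂ x
      have h := congrArg (fun z => φ.rightAction (antipodeInv z))
        (sum_antipodeInv_right_mul_left r)
      rw [← r.eq]
      simpa [antipodeInv_mul, rightAction_mul, rightAction_one, antipodeInv_one,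
        Algebra.algebraMap_eq_smul_one] using h)

/-- `c ⊗ v ↦ c₁ ⊗ S(c₂) ▷ v`, a bijection with inverse `c ⊗ v ↦ c₁ ⊗ c₂ ▷ v`. -/
noncomputable def twistRightEquiv : B ⊗[ℂ] φ.DualAlgebra ≃ₗ[ℂ] B ⊗[ℂ] φ.DualAlgebra :=
  LinearEquiv.ofLinearMap (twistRight (φ.leftAction ∘ₗ antipode ℂ)) (twistRight φ.leftAction)
    (twistRight_comp_twistRight _ _ fun x => by
      let r := Coalgebra.Repr.arbitrary ℂ x
      have h := congrArg φ.leftAction (HopfAlgebra.sum_antipode_mul_eq_algebraMap_counit r)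
      rw [← r.eq]
      simpa [leftAction_mul, leftAction_one, Algebra.algebraMap_eq_smul_one] using h)
    (twistRight_comp_twistRight _ _ fun x => by
      let r := Coalgebra.Repr.arbitrary ℂ x
      have h := congrArg φ.leftAction (HopfAlgebra.sum_mul_antipode_eq_algebraMap_counit r)
      rw [← r.eq]
      simpa [leftAction_mul, leftAction_one, Algebra.algebraMap_eq_smul_one] using h)

/-- The map `a ⊗ b ↦ Δ(a)(1 ⊗ b)` of `A ⊗ A`. -/
noncomputable def canonicalLeft :
    φ.DualAlgebra ⊗[ℂ] φ.DualAlgebra ≃ₗ[ℂ] φ.DualAlgebra ⊗[ℂ] φ.DualAlgebra :=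
  (φ.elemEquiv.symm.lTensor _).trans (φ.twistLeftEquiv.trans (φ.elemEquiv.lTensor _))

/-- The map `a ⊗ b ↦ (a ⊗ 1)Δ(b)` of `A ⊗ A`. -/
noncomputable def canonicalRight :
    φ.DualAlgebra ⊗[ℂ] φ.DualAlgebra ≃ₗ[ℂ] φ.DualAlgebra ⊗[ℂ] φ.DualAlgebra :=
  (φ.elemEquiv.symm.rTensor _).trans (φ.twistRightEquiv.trans (φ.elemEquiv.rTensor _))

theorem canonicalLeft_tmul (a : φ.DualAlgebra) {ι : Type*} {e : B}
    (r : Coalgebra.Repr ℂ e ι) :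
    φ.canonicalLeft (a ⊗ₜ φ.elem e) =
      ∑ i ∈ r.index, φ.rightAction (antipodeInv (r.left i)) a ⊗ₜ φ.elem (r.right i) := by
  change (φ.elemEquiv.lTensor _) (twistLeft _ (a ⊗ₜ φ.elemEquiv.symm (φ.elem e))) = _
  rw [elemEquiv_symm_elem, twistLeft_tmul _ r, map_sum]
  rfl

theorem canonicalRight_tmul (a : φ.DualAlgebra) {ι : Type*} {c : B}
    (r : Coalgebra.Repr ℂ c ι) :
    φ.canonicalRight (φ.elem c ⊗ₜ a) =
      ∑ i ∈ r.index, φ.elem (r.left i) ⊗ₜ φ.leftAction (antipode ℂ (r.right i)) a := by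
  change (φ.elemEquiv.rTensor _) (twistRight _ (φ.elemEquiv.symm (φ.elem c) ⊗ₜ a)) = _
  rw [elemEquiv_symm_elem, twistRight_tmul _ r, map_sum]
  rfl

/-- `a(y₁ x) b(y₂) = ⟨Δ(a)(1 ⊗ b), x ⊗ y⟩` is computed by the strong left invariance of `φ`. -/
theorem tensorIncl_canonicalLeft (a b : φ.DualAlgebra) :
    φ.tensorIncl (φ.canonicalLeft (a ⊗ₜ b)) =
      φ.comulFunctional a * tensorFunctional 1 (φ.incl b) := by
  obtain ⟨e, rfl⟩ := φ.exists_eq_elem b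
  let s := Coalgebra.Repr.arbitrary ℂ e
  rw [φ.canonicalLeft_tmul a s]
  ext x y
  let r := Coalgebra.Repr.arbitrary ℂ x
  let q := Coalgebra.Repr.arbitrary ℂ y
  have h3 := (r.tmul q).convMul_apply (φ.comulFunctional a)
    (tensorFunctional 1 (φ.incl (φ.elem e)))
  refine Eq.trans ?_ h3.symm
  have h := φ.strong_left ((φ.incl a).ofConv ∘ₗ LinearMap.mulRight ℂ x) y s
  rw [← q.eq] at h
  simp only [Finset.sum_mul, map_sum, Algebra.TensorProduct.tmul_mul_tmul, mul_one,
    TensorProduct.map_tmul, LinearMap.mul'_apply] at h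
  simp only [map_sum, WithConv.ofConv_sum, LinearMap.sum_apply,
    TensorProduct.AlgebraTensorModule.curry_apply, LinearMap.restrictScalars_self,
    TensorProduct.curry_apply, tensorIncl_tmul_apply]
  refine h.symm.trans ?_
  simp only [Coalgebra.Repr.tmul, Finset.sum_product]
  rw [Finset.sum_comm]
  refine Finset.sum_congr rfl fun j _ => ?_
  have hx := congrArg (fun z => φ.pairing a (q.left j * z)) (sum_smul_counit r)
  simp only [Finset.mul_sum, mul_smul_comm, pairing, map_sum, map_smul, smul_eq_mul] at hx
  change φ.pairing a (q.left j * x) * φ (q.right j * e) = ∑ i ∈ r.index,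
    φ.pairing a (q.left j * r.left i) * (counit (R := ℂ) (r.right i) * φ (q.right j * e))
  rw [pairing, ← hx, Finset.sum_mul]
  refine Finset.sum_congr rfl fun i _ => ?_
  simp only [pairing]
  ring

/-- `a(x₁) b(y x₂) = ⟨(a ⊗ 1)Δ(b), x ⊗ y⟩` is computed by the strong right invariance of `φ`. -/
theorem tensorIncl_canonicalRight (a b : φ.DualAlgebra) :
    φ.tensorIncl (φ.canonicalRight (a ⊗ₜ b)) =
      tensorFunctional (φ.incl a) 1 * φ.comulFunctional b := by
  obtain ⟨c, rfl⟩ := φ.exists_eq_elem a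
  let s := Coalgebra.Repr.arbitrary ℂ c
  rw [φ.canonicalRight_tmul b s]
  ext x y
  let r := Coalgebra.Repr.arbitrary ℂ x
  let q := Coalgebra.Repr.arbitrary ℂ y
  have h3 := (r.tmul q).convMul_apply (tensorFunctional (φ.incl (φ.elem c)) 1)
    (φ.comulFunctional b)
  refine Eq.trans ?_ h3.symm
  have h := φ.strong_right' ((φ.incl b).ofConv ∘ₗ LinearMap.mulLeft ℂ y) x s
  rw [← r.eq] at h
  simp only [Finset.sum_mul, map_sum, Algebra.TensorProduct.tmul_mul_tmul, mul_one,
    TensorProduct.map_tmul, LinearMap.mul'_apply] at h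
  simp only [map_sum, WithConv.ofConv_sum, LinearMap.sum_apply,
    TensorProduct.AlgebraTensorModule.curry_apply, LinearMap.restrictScalars_self,
    TensorProduct.curry_apply, tensorIncl_tmul_apply, pairing_leftAction]
  refine h.symm.trans ?_
  simp only [Coalgebra.Repr.tmul, Finset.sum_product]
  refine Finset.sum_congr rfl fun i _ => ?_
  have hy := congrArg (fun z => φ.pairing b (z * r.right i)) (Coalgebra.sum_counit_smul q)
  simp only [Finset.sum_mul, smul_mul_assoc, pairing, map_sum, map_smul, smul_eq_mul] at hy
  change φ (r.left i * c) * φ.pairing b (y * r.right i) = ∑ j ∈ q.index,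
    φ (r.left i * c) * counit (R := ℂ) (q.left j) * φ.pairing b (q.right j * r.right i)
  rw [pairing, ← hy, Finset.mul_sum]
  refine Finset.sum_congr rfl fun j _ => ?_
  simp only [pairing]
  ring

theorem tensorIncl_tmul (a b : φ.DualAlgebra) :
    φ.tensorIncl (a ⊗ₜ b) = tensorFunctional (φ.incl a) (φ.incl b) := by
  ext x y; rfl

theorem tensorIncl_oneTmul_left (b : φ.DualAlgebra) (t : φ.DualAlgebra ⊗[ℂ] φ.DualAlgebra) :
    φ.tensorIncl ((oneTmul b).left t) = tensorFunctional 1 (φ.incl b) * φ.tensorIncl t := by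
  induction t with
  | zero => simp
  | add s t hs ht => simp only [map_add, mul_add, hs, ht]
  | tmul c d =>
    change φ.tensorIncl (c ⊗ₜ (b * d)) = _
    rw [tensorIncl_tmul, tensorIncl_tmul, tensorFunctional_mul, one_mul, incl_mul]

theorem tensorIncl_oneTmul_right (b : φ.DualAlgebra) (t : φ.DualAlgebra ⊗[ℂ] φ.DualAlgebra) :
    φ.tensorIncl ((oneTmul b).right t) = φ.tensorIncl t * tensorFunctional 1 (φ.incl b) := by
  induction t with
  | zero => simp
  | add s t hs ht => simp only [map_add, add_mul, hs, ht]
  | tmul c d =>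
    change φ.tensorIncl (c ⊗ₜ (d * b)) = _
    rw [tensorIncl_tmul, tensorIncl_tmul, tensorFunctional_mul, mul_one, incl_mul]

theorem tensorIncl_tmulOne_left (b : φ.DualAlgebra) (t : φ.DualAlgebra ⊗[ℂ] φ.DualAlgebra) :
    φ.tensorIncl ((tmulOne b).left t) = tensorFunctional (φ.incl b) 1 * φ.tensorIncl t := by
  induction t with
  | zero => simp
  | add s t hs ht => simp only [map_add, mul_add, hs, ht]
  | tmul c d =>
    change φ.tensorIncl ((b * c) ⊗ₜ d) = _
    rw [tensorIncl_tmul, tensorIncl_tmul, tensorFunctional_mul, one_mul, incl_mul]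

theorem tensorIncl_tmulOne_right (b : φ.DualAlgebra) (t : φ.DualAlgebra ⊗[ℂ] φ.DualAlgebra) :
    φ.tensorIncl ((tmulOne b).right t) = φ.tensorIncl t * tensorFunctional (φ.incl b) 1 := by
  induction t with
  | zero => simp
  | add s t hs ht => simp only [map_add, add_mul, hs, ht]
  | tmul c d =>
    change φ.tensorIncl ((c * b) ⊗ₜ d) = _
    rw [tensorIncl_tmul, tensorIncl_tmul, tensorFunctional_mul, mul_one, incl_mul]

theorem dualComul_mul_oneTmul (a b : φ.DualAlgebra) :
    φ.dualComul a * oneTmul b = Multiplier.coe (φ.canonicalLeft (a ⊗ₜ b)) := by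
  refine Multiplier.ext (fun t => φ.tensorIncl_injective ?_)
    (fun t => φ.tensorIncl_injective ?_)
  · change φ.tensorIncl (φ.comulLeft a ((oneTmul b).left t)) =
      φ.tensorIncl (φ.canonicalLeft (a ⊗ₜ b) * t)
    rw [tensorIncl_comulLeft, tensorIncl_oneTmul_left, tensorIncl_mul, tensorIncl_canonicalLeft,
      mul_assoc]
  · change φ.tensorIncl ((oneTmul b).right (φ.comulRight a t)) =
      φ.tensorIncl (t * φ.canonicalLeft (a ⊗ₜ b))
    rw [tensorIncl_oneTmul_right, tensorIncl_comulRight, tensorIncl_mul,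
      tensorIncl_canonicalLeft, mul_assoc]

theorem tmulOne_mul_dualComul (a b : φ.DualAlgebra) :
    tmulOne a * φ.dualComul b = Multiplier.coe (φ.canonicalRight (a ⊗ₜ b)) := by
  refine Multiplier.ext (fun t => φ.tensorIncl_injective ?_)
    (fun t => φ.tensorIncl_injective ?_)
  · change φ.tensorIncl ((tmulOne a).left (φ.comulLeft b t)) =
      φ.tensorIncl (φ.canonicalRight (a ⊗ₜ b) * t)
    rw [tensorIncl_tmulOne_left, tensorIncl_comulLeft, tensorIncl_mul,
      tensorIncl_canonicalRight, mul_assoc]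
  · change φ.tensorIncl (φ.comulRight b ((tmulOne a).right t)) =
      φ.tensorIncl (t * φ.canonicalRight (a ⊗ₜ b))
    rw [tensorIncl_comulRight, tensorIncl_tmulOne_right, tensorIncl_mul,
      tensorIncl_canonicalRight, mul_assoc]

/-- Coassociativity of the coproduct comes down to the left and right actions of `B` on its dual
commuting with each other. -/
theorem canonical_coassoc :
    (TensorProduct.assoc ℂ _ _ _).toLinearMap ∘ₗ
        φ.canonicalRight.toLinearMap.rTensor φ.DualAlgebra ∘ₗ
        (TensorProduct.assoc ℂ _ _ _).symm.toLinearMap ∘ₗ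
        φ.canonicalLeft.toLinearMap.lTensor φ.DualAlgebra =
      φ.canonicalLeft.toLinearMap.lTensor φ.DualAlgebra ∘ₗ
        (TensorProduct.assoc ℂ _ _ _).toLinearMap ∘ₗ
        φ.canonicalRight.toLinearMap.rTensor φ.DualAlgebra ∘ₗ
        (TensorProduct.assoc ℂ _ _ _).symm.toLinearMap := by
  refine TensorProduct.ext' fun a t => ?_
  induction t with
  | zero => simp
  | add s t hs ht => simp only [TensorProduct.tmul_add, map_add, hs, ht]
  | tmul b d =>
    obtain ⟨c, rfl⟩ := φ.exists_eq_elem a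
    obtain ⟨e, rfl⟩ := φ.exists_eq_elem d
    let r := Coalgebra.Repr.arbitrary ℂ c
    let s := Coalgebra.Repr.arbitrary ℂ e
    simp only [LinearMap.comp_apply, LinearMap.lTensor_tmul, LinearMap.rTensor_tmul,
      LinearEquiv.coe_coe, TensorProduct.assoc_symm_tmul, TensorProduct.assoc_tmul,
      φ.canonicalLeft_tmul _ s, φ.canonicalRight_tmul _ r, TensorProduct.tmul_sum,
      TensorProduct.sum_tmul, map_sum, leftAction_rightAction]
    exact Finset.sum_comm

theorem isMultiplierHopfStarAlgebra_dualComul : IsMultiplierHopfStarAlgebra φ.dualComul where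
  nondegenerate_left := φ.eq_zero_of_forall_mul_right_eq_zero
  nondegenerate_right := φ.eq_zero_of_forall_mul_left_eq_zero
  exists_canonical_maps := ⟨φ.canonicalLeft, φ.canonicalRight, φ.dualComul_mul_oneTmul,
    φ.tmulOne_mul_dualComul, φ.canonical_coassoc⟩

theorem eq_canonicalLeft {a b : φ.DualAlgebra} {t : φ.DualAlgebra ⊗[ℂ] φ.DualAlgebra}
    (h : φ.dualComul a * oneTmul b = Multiplier.coe t) : t = φ.canonicalLeft (a ⊗ₜ b) :=
  Multiplier.coe_tensor_injective φ.eq_zero_of_forall_mul_right_eq_zero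
    (h.symm.trans (φ.dualComul_mul_oneTmul a b))

theorem eq_canonicalRight {a b : φ.DualAlgebra} {t : φ.DualAlgebra ⊗[ℂ] φ.DualAlgebra}
    (h : tmulOne b * φ.dualComul a = Multiplier.coe t) : t = φ.canonicalRight (b ⊗ₜ a) :=
  Multiplier.coe_tensor_injective φ.eq_zero_of_forall_mul_right_eq_zero
    (h.symm.trans (φ.tmulOne_mul_dualComul b a))

theorem isCounit_dualCounit : IsCounit φ.dualComul φ.dualCounit where
  left a b t h := by
    rw [φ.eq_canonicalLeft h]
    obtain ⟨e, rfl⟩ := φ.exists_eq_elem b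
    let r := Coalgebra.Repr.arbitrary ℂ e
    rw [φ.canonicalLeft_tmul a r, φ.mul_elem a r]
    simp [dualCounit_apply, pairing_rightAction]
  right a b t h := by
    rw [φ.eq_canonicalRight h]
    obtain ⟨c, rfl⟩ := φ.exists_eq_elem b
    let r := Coalgebra.Repr.arbitrary ℂ c
    rw [φ.canonicalRight_tmul a r, φ.elem_mul a r]
    simp [dualCounit_apply, pairing_leftAction]

theorem isLeftIntegral_dualIntegral : IsLeftIntegral φ.dualComul φ.dualIntegral where
  ne_zero h := by
    have := φ.dualIntegral_elem 1
    simp [h] at this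
  left_invariant a b t h := by
    rw [φ.eq_canonicalRight h]
    obtain ⟨c, rfl⟩ := φ.exists_eq_elem b
    obtain ⟨d, rfl⟩ := φ.exists_eq_elem a
    let r := Coalgebra.Repr.arbitrary ℂ c
    rw [φ.canonicalRight_tmul _ r]
    have hc := congrArg φ.elemEquiv (sum_smul_counit r)
    simp only [map_sum, map_smul, elemEquiv_apply] at hc
    rw [← hc]
    simp only [map_sum, LinearMap.lTensor_tmul, TensorProduct.rid_tmul, leftAction_elem,
      dualIntegral_elem, Bialgebra.counit_mul, HopfAlgebra.counit_antipode, Finset.smul_sum,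
      smul_smul, mul_comm]

end PositiveIntegral
end QuantumGroup

theorem mainTheorem6 {B : Type u} [Ring B] [HopfAlgebra ℂ B] [StarRing B] [StarModule ℂ B]
    [QuantumGroup.IsHopfStarAlgebra B] (φ : QuantumGroup.PositiveIntegral B) :
    QuantumGroup.IsDiscreteQuantumGroup φ.dualComul ∧
    QuantumGroup.IsCounit φ.dualComul φ.dualCounit ∧
    (QuantumGroup.IsLeftCointegral φ.dualCounit ((φ 1)⁻¹ • φ.elem 1) ∧
      QuantumGroup.IsRightCointegral φ.dualCounit ((φ 1)⁻¹ • φ.elem 1) ∧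
      star ((φ 1)⁻¹ • φ.elem 1) = (φ 1)⁻¹ • φ.elem 1 ∧
      ((φ 1)⁻¹ • φ.elem 1) * ((φ 1)⁻¹ • φ.elem 1) = (φ 1)⁻¹ • φ.elem 1) ∧
    ∃ φA : φ.DualAlgebra →ₗ[ℂ] ℂ,
      (∀ b : B, φA (φ.elem b) = Coalgebra.counit (R := ℂ) b) ∧
      QuantumGroup.IsLeftIntegral φ.dualComul φA ∧
      (∀ a : φ.DualAlgebra, 0 ≤ φA (star a * a)) ∧
      ∀ b : B, φA (star (φ.elem b) * φ.elem b) = φ (star b * b) := by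
  have h0 : (φ 1)⁻¹ • φ.elem 1 ≠ 0 :=
    smul_ne_zero (inv_ne_zero φ.apply_one_ne_zero) φ.elem_one_ne_zero
  have hleft : ∀ a, a * ((φ 1)⁻¹ • φ.elem 1) = φ.dualCounit a • ((φ 1)⁻¹ • φ.elem 1) :=
    fun a => by rw [mul_smul_comm, φ.mul_elem_one, smul_comm]
  have hright : ∀ a, ((φ 1)⁻¹ • φ.elem 1) * a = φ.dualCounit a • ((φ 1)⁻¹ • φ.elem 1) :=
    fun a => by rw [smul_mul_assoc, φ.elem_one_mul, smul_comm]
  refine ⟨⟨φ.isDirectSumOfMatrixAlgebras_dualAlgebra, φ.isMultiplierHopfStarAlgebra_dualComul⟩,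
    φ.isCounit_dualCounit, ⟨⟨h0, hleft⟩, ⟨h0, hright⟩, ?_, ?_⟩, φ.dualIntegral,
    φ.dualIntegral_elem, φ.isLeftIntegral_dualIntegral, φ.dualIntegral_nonneg,
    φ.dualIntegral_star_mul_self⟩
  · rw [star_smul, star_inv₀, φ.star_elem_one, ← φ.apply_star, star_one]
  · rw [hleft, map_smul, φ.dualCounit_apply, φ.pairing_elem, mul_one, smul_eq_mul,
      inv_mul_cancel₀ φ.apply_one_ne_zero, one_smul]
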